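/- Let $T>0$, $\nu>0$ and $\chi_c\in C_0^\infty(\mathbb R)$. Put $H=L^2(\mathbb R)$, $V=H^1(\mathbb R)$, $W(V)=\{y\in L^2(0,T;V): \partial_t y\in L^2(0,T;V^*)\}$ with $\|y\|_{W(V)}^2=\|y\|_{L^2(0,T;V)}^2+\|\partial_t y\|_{L^2(0,T;V^*)}^2$, and $P=H^1(0,T)^N$ with $$\|\Phi\|_P^2=\sum_{i=1}^N h_i\int_0^T\big(|\Phi_i(t)|^2+|\partial_t\Phi_i(t)|^2\big)\,dt .$$ Let $u\in H^1(0,T)$ with $u_l\le u\le u_u$ a.e. for some real numbers $u_l\le u_u$, and let $y_0\in V$ vanish a.e. outside a bounded interval $[a,b]$. Let $\delta_\varepsilon(x)=\varepsilon^{-1}\zeta(x/\varepsilon)$, $\varepsilon>0$, where $\zeta\in C^\infty(\mathbb R)\cap L^1(\mathbb R)$ satisfies, for some integer $r\ge1$, $\int\zeta=1$, $\int x^k\zeta(x)\,dx=0$ for $1\le k\le r-1$, and $\int|x|^r|\zeta(x)|\,dx<\infty$. Let $(y_h,\Phi)\in (W(V)\cap L^\infty(0,T;V))\times P$ be a particle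 solution of the controlled viscous Burgers equation, that is, for some coefficients $\alpha_i:(0,T)\to\mathbb R$, $$y_h(x,t)=\sum_{i=1}^N\alpha_i(t)\,\delta_\varepsilon(x-\Phi_i(t)),\qquad \partial_t\Phi_i(t)=y_h(\Phi_i(t),t)\quad(i=1,\dots,N)$$ for a.e. $t\in(0,T)$; for all $\phi\in V$ and a.e. $t\in(0,T)$, $$\langle\partial_t y_h(t),\phi\rangle_{V^*,V}+\langle y_h(t)\partial_x y_h(t),\phi\rangle_H+\nu\langle\partial_x y_h(t),\partial_x\phi\rangle_H=\langle\chi_c\,u(t),\phi\rangle_H ;$$ and $\langle y_h(0),\psi\rangle_H=\langle y_0,\psi\rangle_H$ for all $\psi\in H$. Then, with $$C_{\mathrm{state}}=C\big(\|u\|_{L^2(0,T)}+\|y_0\|_V\big)\exp\!\big(C(\|u\|_{L^2(0,T)}^2+\|y_0\|_H^2)\big),$$ where $C>0$ depends only on $\nu$, $T$ and $\chi_c$, $$\|y_h\|_{L^\infty(0,T;V)}+\|y_h\|_{W(V)}\le C_{\mathrm{state}} .$$ Moreover, let $\eta>0$, suppose that the initial positions $X_i=\Phi_i(0)$ satisfy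 $a-\eta\le X_1<\dots<X_N\le b+\eta$, and let the initial point distances satisfy $0<h_i\le X_{i+1}-X_{i-1}$ for $i=1,\dots,N$, where $X_0:=a-\eta$ and $X_{N+1}:=b+\eta$. Then, with the same $C_{\mathrm{state}}$, $$\|\Phi\|_P\le C_{\mathrm{state}}+C_{\mathrm{supp}},$$ where $C_{\mathrm{supp}}>0$ depends only on $a$, $b$, $\eta$ and the fixed final time $T$ (in particular not on $\nu,\chi_c,u,y_0,\zeta,\varepsilon,N,\Phi$ or the $h_i$). -/

import Mathlib

open MeasureTheory Set
open scoped ContDiff ENNReal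

noncomputable section

namespace Burgers

/-- `g` is the weak (distributional) derivative of `f` on the open set `U ⊆ ℝ`. -/
def IsWeakDeriv (U : Set ℝ) (f g : ℝ → ℝ) : Prop :=
  ∀ φ : ℝ → ℝ, ContDiff ℝ ∞ φ → HasCompactSupport φ → tsupport φ ⊆ U →
    ∫ x, f x * deriv φ x = -∫ x, g x * φ x

/-- `H = L²(ℝ)`. -/
abbrev H : Type := Lp ℝ 2 (volume : Measure ℝ)

theorem H.integrable_mul (f : H) {φ : ℝ → ℝ} (hφ : Continuous φ) (hc : HasCompactSupport φ) :
    Integrable (fun x => f x * φ x) :=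
  (Lp.memLp f).integrable_mul (hφ.memLp_of_hasCompactSupport (p := 2) hc)

/-- The subspace of pairs `(f, f')` in `L²(ℝ) × L²(ℝ)` such that `f'` is the weak derivative of `f`,
with the inner product `⟪f, g⟫ + ⟪f', g'⟫`. -/
def sobolevSubspace : Submodule ℝ (WithLp 2 (H × H)) where
  carrier := {p | IsWeakDeriv univ p.fst p.snd}
  zero_mem' := by
    intro φ _ _ _
    have key : ∀ ψ : ℝ → ℝ, ∫ x, ((0 : H) : ℝ → ℝ) x * ψ x = 0 := by
      intro ψ
      refine integral_eq_zero_of_ae ?_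
      filter_upwards [Lp.coeFn_zero ℝ 2 (volume : Measure ℝ)] with x hx
      rw [hx, Pi.zero_apply, zero_mul]
    change ∫ x, ((0 : H) : ℝ → ℝ) x * deriv φ x = -∫ x, ((0 : H) : ℝ → ℝ) x * φ x
    rw [key, key, neg_zero]
  add_mem' := by
    intro p q hp hq φ hφ hc hs
    have hd : Continuous (deriv φ) := hφ.continuous_deriv (by simp)
    have key : ∀ (f g : H) (ψ : ℝ → ℝ), Continuous ψ → HasCompactSupport ψ →
        ∫ x, ((f + g : H) : ℝ → ℝ) x * ψ x = (∫ x, f x * ψ x) + ∫ x, g x * ψ x := by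
      intro f g ψ h1 h2
      rw [← integral_add (f.integrable_mul h1 h2) (g.integrable_mul h1 h2)]
      refine integral_congr_ae ?_
      filter_upwards [Lp.coeFn_add f g] with x hx
      rw [hx, Pi.add_apply, add_mul]
    have e1 := hp φ hφ hc hs
    have e2 := hq φ hφ hc hs
    change ∫ x, ((p.fst + q.fst : H) : ℝ → ℝ) x * deriv φ x
      = -∫ x, ((p.snd + q.snd : H) : ℝ → ℝ) x * φ x
    rw [key _ _ _ hd hc.deriv, key _ _ _ hφ.continuous hc, e1, e2]
    ring
  smul_mem' := by
    intro c p hp φ hφ hc hs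
    have key : ∀ (f : H) (ψ : ℝ → ℝ),
        ∫ x, ((c • f : H) : ℝ → ℝ) x * ψ x = c * ∫ x, f x * ψ x := by
      intro f ψ
      rw [← integral_const_mul]
      refine integral_congr_ae ?_
      filter_upwards [Lp.coeFn_smul c f] with x hx
      rw [hx, Pi.smul_apply, smul_eq_mul, mul_assoc]
    have e1 := hp φ hφ hc hs
    change ∫ x, ((c • p.fst : H) : ℝ → ℝ) x * deriv φ x
      = -∫ x, ((c • p.snd : H) : ℝ → ℝ) x * φ x
    rw [key, key, e1]
    ring

/-- `V = H¹(ℝ)`, with the inner product `⟪f, g⟫ + ⟪f', g'⟫`. -/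
def V : Type := sobolevSubspace

instance : NormedAddCommGroup V := inferInstanceAs (NormedAddCommGroup sobolevSubspace)

instance : InnerProductSpace ℝ V := inferInstanceAs (InnerProductSpace ℝ sobolevSubspace)

/-- The embedding `V ↪ H`. -/
def toH (v : V) : H := v.1.fst

/-- The spatial derivative `∂ₓ : V → H`. -/
def dx (v : V) : H := v.1.snd

/-- The dual space `V*` with the operator norm. -/
abbrev VDual : Type := V →L[ℝ] ℝ

/-- Shortcut for instance search; the structure is Mathlib's. -/
instance : ESeminormedAddMonoid VDual := inferInstance

/-- Lebesgue measure on `(0,T)`. -/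
def timeMeasure (T : ℝ) : Measure ℝ := volume.restrict (Ioo 0 T)

/-- The norm of `L²(0,T;E)`. -/
def normL2 {E : Type*} [NormedAddCommGroup E] (T : ℝ) (f : ℝ → E) : ℝ :=
  (eLpNorm f 2 (timeMeasure T)).toReal

/-- The norm of `L^∞(0,T;E)`. -/
def normLinf {E : Type*} [NormedAddCommGroup E] (T : ℝ) (f : ℝ → E) : ℝ :=
  (eLpNorm f ∞ (timeMeasure T)).toReal

/-- `y ∈ W(V)` with `∂ₜ y = dy`: `y ∈ L²(0,T;V)`, `dy ∈ L²(0,T;V*)` and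
`d/dt ⟪y, φ⟫_H = ⟨dy, φ⟩` in the sense of distributions on `(0,T)`, for all `φ ∈ V`. -/
structure MemW (T : ℝ) (y : ℝ → V) (dy : ℝ → VDual) : Prop where
  memLp : MemLp y 2 (timeMeasure T)
  memLp_deriv : MemLp dy 2 (timeMeasure T)
  weakDeriv : ∀ φ : V,
    IsWeakDeriv (Ioo 0 T) (fun t => inner ℝ (toH (y t)) (toH φ)) (fun t => dy t φ)

/-- The norm of `W(V)`, where `dy = ∂ₜ y`. -/
def normW (T : ℝ) (y : ℝ → V) (dy : ℝ → VDual) : ℝ :=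
  √(normL2 T y ^ 2 + normL2 T dy ^ 2)

/-- `f ∈ H¹(0,T)` with weak derivative `df`. -/
structure MemH1Time (T : ℝ) (f df : ℝ → ℝ) : Prop where
  memLp : MemLp f 2 (timeMeasure T)
  memLp_deriv : MemLp df 2 (timeMeasure T)
  weakDeriv : IsWeakDeriv (Ioo 0 T) f df

/-- The admissible controls: `u ∈ H¹(0,T)` with `ul ≤ u(t) ≤ uu` almost everywhere. -/
def Admissible (T ul uu : ℝ) (u : ℝ → ℝ) : Prop :=
  (∃ du, MemH1Time T u du) ∧ ∀ᵐ t ∂timeMeasure T, ul ≤ u t ∧ u t ≤ uu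

/-- `v` vanishes almost everywhere outside `[a,b]`. -/
def SupportedIn (v : V) (a b : ℝ) : Prop :=
  ∀ᵐ x : ℝ, x ∉ Icc a b → toH v x = 0

/-- A smooth kernel of order `r ≥ 1`: unit mass and vanishing moments of orders `1, …, r - 1`. -/
structure IsKernel (r : ℕ) (ζ : ℝ → ℝ) : Prop where
  one_le : 1 ≤ r
  smooth : ContDiff ℝ ∞ ζ
  integrable : Integrable ζ
  integral_eq_one : ∫ x, ζ x = 1
  moments : ∀ k : ℕ, 1 ≤ k → k ≤ r - 1 → ∫ x, x ^ k * ζ x = 0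
  integrable_moment : Integrable (fun x => |x| ^ r * |ζ x|)

/-- `δ_ε(x) = ε⁻¹ ζ(ε⁻¹ x)`. -/
def deltaEps (ζ : ℝ → ℝ) (ε : ℝ) (x : ℝ) : ℝ := ε⁻¹ * ζ (ε⁻¹ * x)

/-- `∑ᵢ αᵢ(t) δ_ε(x - Φᵢ(t))`. -/
def particleSum (ζ : ℝ → ℝ) (ε : ℝ) {N : ℕ} (α Φ : Fin N → ℝ → ℝ) (t x : ℝ) : ℝ :=
  ∑ i, α i t * deltaEps ζ ε (x - Φ i t)

/-- The initial condition `⟪y(0), ψ⟫_H = ⟪y₀, ψ⟫_H` for all `ψ ∈ H`; here `y(0)` is the value at `0`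
of the representative of `y` in `C([0,T]; H)`. -/
def HasInitialValue (T : ℝ) (y : ℝ → V) (y0 : V) : Prop :=
  ∃ z : ℝ → H, ContinuousOn z (Icc 0 T) ∧ (∀ᵐ t ∂timeMeasure T, z t = toH (y t)) ∧
    ∀ ψ : H, inner ℝ (z 0) ψ = inner ℝ (toH y0) ψ

/-- The weak viscous Burgers equation: for all `φ ∈ V` and almost every `t ∈ (0,T)`,
`⟨∂ₜ y, φ⟩ + ⟪y ∂ₓ y, φ⟫_H + ν ⟪∂ₓ y, ∂ₓ φ⟫_H = ⟪χ u(t), φ⟫_H`, with `dy = ∂ₜ y`. -/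
def WeakBurgers (ν T : ℝ) (χ u : ℝ → ℝ) (y : ℝ → V) (dy : ℝ → VDual) : Prop :=
  ∀ φ : V, ∀ᵐ t ∂timeMeasure T,
    dy t φ + (∫ x, (toH (y t) x * dx (y t) x) * toH φ x) + ν * inner ℝ (dx (y t)) (dx φ)
      = ∫ x, (χ x * u t) * toH φ x

/-- `(y, Φ) ∈ (W(V) ∩ L^∞(V)) × P` is a particle solution: `y` has the particle form with positions
`Φᵢ`, the particles move with the velocity `y`, and `y` satisfies the weak Burgers equation with
initial value `y0`.  Here `dy = ∂ₜ y` and `dΦ = ∂ₜ Φ`; `Φᵢ` denotes the continuous representative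
on `[0,T]`, so that `Φᵢ(0)` is the initial position. -/
structure IsParticleSolution (ν T : ℝ) (χ u : ℝ → ℝ) (y0 : V) (ζ : ℝ → ℝ) (ε : ℝ) {N : ℕ}
    (y : ℝ → V) (dy : ℝ → VDual) (Φ dΦ : Fin N → ℝ → ℝ) : Prop where
  memW : MemW T y dy
  memLinf : MemLp y ∞ (timeMeasure T)
  memP : ∀ i, MemH1Time T (Φ i) (dΦ i)
  continuousOn : ∀ i, ContinuousOn (Φ i) (Icc 0 T)
  particle : ∃ α : Fin N → ℝ → ℝ,
    (∀ᵐ t ∂timeMeasure T, ∀ᵐ x : ℝ, toH (y t) x = particleSum ζ ε α Φ t x) ∧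
    (∀ i, ∀ᵐ t ∂timeMeasure T, dΦ i t = particleSum ζ ε α Φ t (Φ i t))
  equation : WeakBurgers ν T χ u y dy
  initial : HasInitialValue T y y0

/-- The norm of `P = H¹(0,T)^N` with weights `h`, where `dΦ = ∂ₜ Φ`. -/
def normP (T : ℝ) {N : ℕ} (h : Fin N → ℝ) (Φ dΦ : Fin N → ℝ → ℝ) : ℝ :=
  √(∑ i, h i * (∫ t, Φ i t * Φ i t ∂timeMeasure T)
    + ∑ i, h i * (∫ t, dΦ i t * dΦ i t ∂timeMeasure T))

/-- The left neighbour of `X i`; for the first point it is the left end `A` of the interval. -/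
def leftNeighbour (A : ℝ) {N : ℕ} (X : Fin N → ℝ) (i : Fin N) : ℝ :=
  if 0 < (i : ℕ) then X ⟨(i : ℕ) - 1, lt_of_le_of_lt (Nat.sub_le _ _) i.isLt⟩ else A

/-- The right neighbour of `X i`; for the last point it is the right end `B` of the interval. -/
def rightNeighbour (B : ℝ) {N : ℕ} (X : Fin N → ℝ) (i : Fin N) : ℝ :=
  if hi : (i : ℕ) + 1 < N then X ⟨(i : ℕ) + 1, hi⟩ else B

/-- `X` is a set of initial particle positions in the neighbourhood `[a - η, b + η]` of `[a,b]`, in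
increasing order, with positive point distances `h i` that do not exceed the distance between the
two neighbours of `X i`.  This contains the usual conventions: `X (i+1) - X i`, `X i - X (i-1)`,
their mean, the spacing of a uniform grid, and the length of a cell around `X i`. -/
structure IsInitialGrid (a b η : ℝ) {N : ℕ} (X h : Fin N → ℝ) : Prop where
  strictMono : StrictMono X
  mem_Icc : ∀ i, X i ∈ Icc (a - η) (b + η)
  distance_pos : ∀ i, 0 < h i
  distance_le : ∀ i, h i ≤ rightNeighbour (b + η) X i - leftNeighbour (a - η) X i

/-- `C (‖u‖_{L²(0,T)} + ‖y₀‖_V) exp (C (‖u‖²_{L²(0,T)} + ‖y₀‖²_H))`. -/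
def Cstate (C T : ℝ) (u : ℝ → ℝ) (y0 : V) : ℝ :=
  C * (normL2 T u + ‖y0‖) * Real.exp (C * (normL2 T u ^ 2 + ‖toH y0‖ ^ 2))

end Burgers

end

/-!
Testing the equation with `y` kills the convection term, since `⟪y ∂ₓy, y⟫_H = 0`, so Grönwall's
inequality bounds `y` in `L^∞(0,T;H) ∩ L²(0,T;V)` by the data.

For the `L^∞(0,T;V)` bound, `f - y ∂ₓy` is regarded as the source of a heat equation, to be tested
with `-∂ₓ²y`. As `y(t)` is only in `V`, this is replaced by `J A y`, where `J = (1 - l ∂ₓ²)⁻¹` and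
`A = (1 - J) / l` is the Yosida approximation of `-∂ₓ²`; as `l → 0` this leaves
`‖∂ₓy(t)‖² ≤ ‖∂ₓy₀‖² + (1 / 2ν) ∫₀ᵗ ‖f - y ∂ₓy‖²`. Since `‖y ∂ₓy‖ ≤ ‖y‖_V ‖∂ₓy‖`, Grönwall's
inequality applies with the weight `‖y‖_V²`, whose integral is bounded by the energy estimate: this
is where the exponential in `C_state` comes from. The equation then bounds `∂ₜy` in `V*`.

The particles move with the velocity `y(Φᵢ(t), t)`, which is at most `‖y(t)‖_V`, so
`∫ |∂ₜΦᵢ|² ≤ ‖y‖²_{L²(0,T;V)}`, and by telescoping the weights `hᵢ` add up to at most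
`2 (b - a + 2η)`.
-/

namespace Burgers

open Filter Topology

theorem isWeakDeriv_integral {g : ℝ → ℝ} (hg : LocallyIntegrable g) (c : ℝ) (U : Set ℝ) :
    IsWeakDeriv U (fun x => ∫ s in c..x, g s) g := by
  intro φ hφ hφc _
  obtain ⟨r, hr⟩ := (hφc.isCompact.insert c).isBounded.subset_ball 0
  rw [Real.ball_eq_Ioo, zero_sub, zero_add] at hr
  have hsupp : tsupport φ ⊆ Ioo (-r) r := (subset_insert _ _).trans hr
  have hφ_out {x : ℝ} (hx : x ∉ Ioo (-r) r) : φ x = 0 :=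
    image_eq_zero_of_notMem_tsupport fun h => hx (hsupp h)
  have integral_eq (F : ℝ → ℝ) {ψ : ℝ → ℝ} (hψ : Function.support ψ ⊆ tsupport φ) :
      ∫ x, F x * ψ x = ∫ x in (-r)..r, F x * ψ x :=
    (intervalIntegral.integral_eq_integral_of_support_subset <|
      (Function.support_mul_subset_right F ψ).trans <| hψ.trans <|
        hsupp.trans Ioo_subset_Ioc_self).symm
  have hG : AbsolutelyContinuousOnInterval (fun x => ∫ s in c..x, g s) (-r) r :=
    ((hg.integrableOn_isCompact isCompact_uIcc).intervalIntegrable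
      ).absolutelyContinuousOnInterval_intervalIntegral
        (Icc_subset_uIcc (Ioo_subset_Icc_self (hr (mem_insert c _))))
  have hφ_ac : AbsolutelyContinuousOnInterval φ (-r) r :=
    (hφ.of_le (by simp)).contDiffOn.absolutelyContinuousOnInterval
  rw [integral_eq _ support_deriv_subset, integral_eq _ (subset_tsupport φ),
    hG.integral_mul_deriv_eq_deriv_mul hφ_ac, hφ_out (by simp), hφ_out (by simp), mul_zero,
    mul_zero, sub_zero, zero_sub]
  refine congrArg Neg.neg (intervalIntegral.integral_congr_ae ?_)
  filter_upwards [LocallyIntegrable.ae_hasDerivAt_integral hg] with x hx _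
  rw [(hx c).deriv]

theorem exists_primitive_hasCompactSupport {U : Set ℝ} [hU : U.OrdConnected] {ψ : ℝ → ℝ}
    (hψ : ContDiff ℝ ∞ ψ) (hψc : HasCompactSupport ψ) (hψU : tsupport ψ ⊆ U)
    (hψ_int : ∫ x, ψ x = 0) :
    ∃ φ : ℝ → ℝ, ContDiff ℝ ∞ φ ∧ HasCompactSupport φ ∧ tsupport φ ⊆ U ∧ deriv φ = ψ := by
  rcases (tsupport ψ).eq_empty_or_nonempty with hempty | hne
  · obtain rfl : ψ = 0 := tsupport_eq_empty_iff.1 hempty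
    exact ⟨0, hψ, hψc, hψU, deriv_zero⟩
  obtain ⟨α, hα, hα_le⟩ := hψc.isCompact.exists_isLeast hne
  obtain ⟨β, hβ, hle_β⟩ := hψc.isCompact.exists_isGreatest hne
  set φ : ℝ → ℝ := fun x => ∫ s in (α - 1)..x, ψ s
  have hφ_deriv (x : ℝ) : HasDerivAt φ (ψ x) x :=
    hψ.continuous.integral_hasStrictDerivAt _ x |>.hasDerivAt
  have hφ_deriv_eq : deriv φ = ψ := funext fun x => (hφ_deriv x).deriv
  have hφ_supp : Function.support φ ⊆ Icc α β := by
    refine fun x hx => ⟨?_, ?_⟩ <;> by_contra! hlt <;> refine hx ?_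
    · refine intervalIntegral.integral_zero_ae (Eventually.of_forall fun s hs => ?_)
      refine image_eq_zero_of_notMem_tsupport fun hsm => ?_
      have := hα_le hsm
      rcases mem_uIoc.1 hs with h | h <;> linarith [h.2]
    · refine (intervalIntegral.integral_eq_integral_of_support_subset fun s hs => ?_).trans hψ_int
      have hs := subset_tsupport _ hs
      exact ⟨by linarith [hα_le hs], by linarith [hle_β hs]⟩
  refine ⟨φ, contDiff_infty_iff_deriv.2 ⟨fun x => (hφ_deriv x).differentiableAt, ?_⟩,
    HasCompactSupport.of_support_subset_isCompact isCompact_Icc hφ_supp,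
    (closure_minimal hφ_supp isClosed_Icc).trans (hU.out (hψU hα) (hψU hβ)), hφ_deriv_eq⟩
  rwa [hφ_deriv_eq]

theorem IsWeakDeriv.sub {U : Set ℝ} {f₁ f₂ g₁ g₂ : ℝ → ℝ} (hf₁ : LocallyIntegrable f₁)
    (hf₂ : LocallyIntegrable f₂) (hg₁ : LocallyIntegrable g₁) (hg₂ : LocallyIntegrable g₂)
    (h₁ : IsWeakDeriv U f₁ g₁) (h₂ : IsWeakDeriv U f₂ g₂) :
    IsWeakDeriv U (fun x => f₁ x - f₂ x) (fun x => g₁ x - g₂ x) := by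
  intro φ hφ hφc hφU
  have integrable_mul {f ψ : ℝ → ℝ} (hf : LocallyIntegrable f) (hψ : Continuous ψ)
      (hψc : HasCompactSupport ψ) : Integrable (fun x => f x * ψ x) :=
    hf.integrable_smul_right_of_hasCompactSupport hψ hψc
  have hdφ : Continuous (deriv φ) := hφ.continuous_deriv (by simp)
  simp only [sub_mul]
  rw [integral_sub (integrable_mul hf₁ hdφ hφc.deriv) (integrable_mul hf₂ hdφ hφc.deriv),
    integral_sub (integrable_mul hg₁ hφ.continuous hφc) (integrable_mul hg₂ hφ.continuous hφc),
    h₁ φ hφ hφc hφU, h₂ φ hφ hφc hφU]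
  ring

theorem exists_contDiff_tsupport_subset_integral_eq_one {U : Set ℝ} (hU : IsOpen U)
    (hne : U.Nonempty) :
    ∃ ρ : ℝ → ℝ, ContDiff ℝ ∞ ρ ∧ HasCompactSupport ρ ∧ tsupport ρ ⊆ U ∧ ∫ x, ρ x = 1 := by
  obtain ⟨p, hp⟩ := hne
  obtain ⟨d, hd, hdU⟩ := Metric.nhds_basis_closedBall.mem_iff.1 (hU.mem_nhds hp)
  let b : ContDiffBump p := ⟨d / 2, d, half_pos hd, half_lt_self hd⟩
  exact ⟨b.normed volume, b.contDiff_normed, b.hasCompactSupport_normed,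
    b.tsupport_normed_eq.trans_subset hdU, b.integral_normed⟩

-- With `∫ ρ = 1`, every test function `ψ` is `(∫ ψ) ρ` plus the derivative of a test function.
theorem IsWeakDeriv.exists_ae_eq_const {U : Set ℝ} (hUo : IsOpen U) [U.OrdConnected] {f : ℝ → ℝ}
    (hf : LocallyIntegrable f) (h : IsWeakDeriv U f 0) : ∃ c : ℝ, ∀ᵐ x, x ∈ U → f x = c := by
  rcases U.eq_empty_or_nonempty with rfl | hne
  · exact ⟨0, by simp⟩
  obtain ⟨ρ, hρ, hρc, hρU, hρ_one⟩ := exists_contDiff_tsupport_subset_integral_eq_one hUo hne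
  have integrable_mul {ψ : ℝ → ℝ} (hψ : Continuous ψ) (hψc : HasCompactSupport ψ) :
      Integrable (fun x => f x * ψ x) :=
    hf.integrable_smul_right_of_hasCompactSupport hψ hψc
  have hρ_int : Integrable ρ := hρ.continuous.integrable_of_hasCompactSupport hρc
  refine ⟨∫ x, f x * ρ x, ?_⟩
  suffices ∀ᵐ x, x ∈ U → f x - ∫ x, f x * ρ x = 0 by simpa only [sub_eq_zero] using this
  refine hUo.ae_eq_zero_of_integral_contDiff_smul_eq_zero
    ((hf.sub continuous_const.locallyIntegrable).locallyIntegrableOn U) fun ψ hψ hψc hψU => ?_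
  have hψ_int : Integrable ψ := hψ.continuous.integrable_of_hasCompactSupport hψc
  set m := ∫ x, ψ x
  obtain ⟨φ, hφ, hφc, hφU, hφ_deriv⟩ := exists_primitive_hasCompactSupport (U := U)
    (ψ := fun x => ψ x - m * ρ x) (hψ.sub (contDiff_const.mul hρ))
    (hψc.sub (hρc.mul_left (f := fun _ => m)))
    ((tsupport_sub _ _).trans (union_subset hψU
      ((closure_mono (Function.support_const_smul_subset m ρ)).trans hρU)))
    (by rw [integral_sub hψ_int (hρ_int.const_mul m), integral_const_mul, hρ_one, mul_one,
      sub_self])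
  have horth : (∫ x, f x * ψ x) - m * ∫ x, f x * ρ x = 0 := by
    have := h φ hφ hφc hφU
    simp only [hφ_deriv, mul_sub, mul_left_comm (f _), Pi.zero_apply, zero_mul, integral_zero,
      neg_zero] at this
    rwa [integral_sub (integrable_mul hψ.continuous hψc)
      ((integrable_mul hρ.continuous hρc).const_mul m), integral_const_mul] at this
  simp only [smul_eq_mul, mul_comm (ψ _), sub_mul]
  rw [integral_sub (integrable_mul hψ.continuous hψc) (hψ_int.const_mul _), integral_const_mul,
    mul_comm, horth]

theorem IsWeakDeriv.exists_eq_add_integral {U : Set ℝ} (hUo : IsOpen U) [U.OrdConnected]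
    {f g : ℝ → ℝ} (hf : LocallyIntegrable f) (hg : LocallyIntegrable g)
    (h : IsWeakDeriv U f g) (x₀ : ℝ) :
    ∃ c : ℝ, ∀ᵐ x, x ∈ U → f x = c + ∫ s in x₀..x, g s := by
  have hG : LocallyIntegrable fun x => ∫ s in x₀..x, g s :=
    (intervalIntegral.continuous_primitive (fun a b =>
      (hg.integrableOn_isCompact isCompact_uIcc).intervalIntegrable) x₀).locallyIntegrable
  have hsub := h.sub hf hG hg hg (isWeakDeriv_integral hg x₀ U)
  simp only [sub_self] at hsub
  obtain ⟨c, hc⟩ := IsWeakDeriv.exists_ae_eq_const hUo (hf.sub hG) hsub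
  refine ⟨c, ?_⟩
  filter_upwards [hc] with x hx hxU
  rw [← hx hxU, Pi.sub_apply, sub_add_cancel]

theorem tendsto_cocompact_zero_of_sub_eq_integral {F g : ℝ → ℝ} (hF : Integrable F)
    (hg : Integrable g) (h : ∀ a b, F b - F a = ∫ x in a..b, g x) :
    Tendsto F (cocompact ℝ) (𝓝 0) := by
  rw [cocompact_eq_atBot_atTop, tendsto_sup]
  constructor
  · have hlim := (intervalIntegral_tendsto_integral_Iic 0 hg.integrableOn
      tendsto_id).const_sub (F 0)
    simp only [id, ← h, sub_sub_cancel] at hlim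
    convert hlim
    refine ((hF.integrableAtFilter _).eq_zero_of_tendsto (fun s hs => ?_)
      hlim).symm
    obtain ⟨a, ha⟩ := mem_atBot_sets.1 hs
    exact measure_mono_top (fun x hx => ha x hx) Real.volume_Iic
  · have hlim := (intervalIntegral_tendsto_integral_Ioi 0 hg.integrableOn
      tendsto_id).const_add (F 0)
    simp only [id, ← h, add_sub_cancel] at hlim
    convert hlim
    refine ((hF.integrableAtFilter _).eq_zero_of_tendsto (fun s hs => ?_)
      hlim).symm
    obtain ⟨a, ha⟩ := mem_atTop_sets.1 hs
    exact measure_mono_top (fun x hx => ha x hx) Real.volume_Ici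

theorem H.inner_eq_integral (f g : H) : inner ℝ f g = ∫ x, f x * g x := by
  simp only [L2.inner_def, RCLike.inner_apply, conj_trivial, mul_comm]

theorem H.inner_toLp (f : H) {φ : ℝ → ℝ} (hφ : MemLp φ 2) :
    inner ℝ f (hφ.toLp φ) = ∫ x, f x * φ x := by
  rw [H.inner_eq_integral]
  refine integral_congr_ae ?_
  filter_upwards [hφ.coeFn_toLp] with x hx
  rw [hx]

theorem H.norm_sq_eq_integral (f : H) : ‖f‖ ^ 2 = ∫ x, f x ^ 2 := by
  simp only [← real_inner_self_eq_norm_sq, H.inner_eq_integral, ← sq]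

theorem H.integrable_sq (f : H) : Integrable fun x => f x ^ 2 := (Lp.memLp f).integrable_sq

theorem H.integrable_mul_coe (f g : H) : Integrable fun x => f x * g x :=
  (Lp.memLp f).integrable_mul (Lp.memLp g)

theorem H.locallyIntegrable (f : H) : LocallyIntegrable f :=
  (Lp.memLp f).locallyIntegrable one_le_two

theorem H.intervalIntegrable (f : H) (a b : ℝ) : IntervalIntegrable f volume a b :=
  (f.locallyIntegrable.integrableOn_isCompact isCompact_uIcc).intervalIntegrable

theorem V.inner_eq (v w : V) :
    inner ℝ v w = inner ℝ (toH v) (toH w) + inner ℝ (dx v) (dx w) := rfl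

theorem V.norm_sq_eq (v : V) : ‖v‖ ^ 2 = ‖toH v‖ ^ 2 + ‖dx v‖ ^ 2 := by
  simp only [← real_inner_self_eq_norm_sq, V.inner_eq]

theorem norm_toH_le (v : V) : ‖toH v‖ ≤ ‖v‖ :=
  le_of_sq_le_sq (by linarith [V.norm_sq_eq v, sq_nonneg ‖dx v‖]) (norm_nonneg v)

theorem norm_dx_le (v : V) : ‖dx v‖ ≤ ‖v‖ :=
  le_of_sq_le_sq (by linarith [V.norm_sq_eq v, sq_nonneg ‖toH v‖]) (norm_nonneg v)

/-- The embedding `V ↪ H` as a continuous linear map. -/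
noncomputable def toHL : V →L[ℝ] H :=
  LinearMap.mkContinuous ⟨⟨toH, fun _ _ => rfl⟩, fun _ _ => rfl⟩ 1 fun v => by
    rw [one_mul]; exact norm_toH_le v

/-- The spatial derivative `∂ₓ : V → H` as a continuous linear map. -/
noncomputable def dxL : V →L[ℝ] H :=
  LinearMap.mkContinuous ⟨⟨dx, fun _ _ => rfl⟩, fun _ _ => rfl⟩ 1 fun v => by
    rw [one_mul]; exact norm_dx_le v

@[simp] theorem toHL_apply (v : V) : toHL v = toH v := rfl

theorem isClosed_sobolevSubspace : IsClosed (sobolevSubspace : Set (WithLp 2 (H × H))) := by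
  have hcoe : (sobolevSubspace : Set (WithLp 2 (H × H))) =
      ⋂ (φ : ℝ → ℝ) (_ : ContDiff ℝ ∞ φ) (_ : HasCompactSupport φ) (_ : tsupport φ ⊆ univ),
        {p | ∫ x, p.fst x * deriv φ x = -∫ x, p.snd x * φ x} := by
    ext p
    simp only [mem_iInter]
    rfl
  have continuous_integral {ψ : ℝ → ℝ} (hψ : Continuous ψ) (hψc : HasCompactSupport ψ) :
      Continuous fun f : H => ∫ x, f x * ψ x := by
    simp only [← H.inner_toLp _ (hψ.memLp_of_hasCompactSupport hψc)]
    fun_prop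
  rw [hcoe]
  refine isClosed_iInter fun φ => isClosed_iInter fun hφ => isClosed_iInter fun hφc =>
    isClosed_iInter fun _ => ?_
  exact isClosed_eq
    ((continuous_integral (hφ.continuous_deriv (by simp)) hφc.deriv).comp (by fun_prop))
    ((continuous_integral hφ.continuous hφc).comp (by fun_prop)).neg

instance : CompleteSpace V :=
  haveI := isClosed_sobolevSubspace.completeSpace_coe
  inferInstanceAs (CompleteSpace sobolevSubspace)

instance : SecondCountableTopology V :=
  haveI : Fact ((2 : ℝ≥0∞) ≠ ⊤) := ⟨ENNReal.ofNat_ne_top⟩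
  haveI : SecondCountableTopology (WithLp 2 (H × H)) :=
    (WithLp.prodContinuousLinearEquiv 2 ℝ H H).toHomeomorph.secondCountableTopology
  inferInstanceAs (SecondCountableTopology sobolevSubspace)

theorem exists_continuous_rep (v : V) : ∃ w : ℝ → ℝ, Continuous w ∧ (∀ᵐ x, toH v x = w x) ∧
    ∀ a b, w b - w a = ∫ s in a..b, dx v s := by
  obtain ⟨c, hc⟩ := IsWeakDeriv.exists_eq_add_integral isOpen_univ
    (toH v).locallyIntegrable (dx v).locallyIntegrable v.2 0
  refine ⟨fun x => c + ∫ s in 0..x, dx v s,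
    (intervalIntegral.continuous_primitive (dx v).intervalIntegrable 0).const_add c,
    hc.mono fun x hx => hx (mem_univ x), fun a b => ?_⟩
  rw [add_sub_add_left_eq_sub, intervalIntegral.integral_interval_sub_left
    ((dx v).intervalIntegrable 0 b) ((dx v).intervalIntegrable 0 a)]

/-- The continuous representative of `v ∈ H¹(ℝ)`. -/
noncomputable def rep (v : V) : ℝ → ℝ := (exists_continuous_rep v).choose

theorem continuous_rep (v : V) : Continuous (rep v) := (exists_continuous_rep v).choose_spec.1

theorem toH_ae_eq_rep (v : V) : ∀ᵐ x, toH v x = rep v x :=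
  (exists_continuous_rep v).choose_spec.2.1

theorem rep_sub_rep (v : V) (a b : ℝ) : rep v b - rep v a = ∫ s in a..b, dx v s :=
  (exists_continuous_rep v).choose_spec.2.2 a b

theorem eq_rep_of_ae_eq {v : V} {w : ℝ → ℝ} (hw : Continuous w) (h : ∀ᵐ x, toH v x = w x) :
    w = rep v :=
  (hw.ae_eq_iff_eq volume (continuous_rep v)).1 <| by
    filter_upwards [h, toH_ae_eq_rep v] with x hx hx'
    rw [← hx, hx']

theorem ae_hasDerivAt_rep (v : V) : ∀ᵐ x, HasDerivAt (rep v) (dx v x) x := by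
  filter_upwards [LocallyIntegrable.ae_hasDerivAt_integral (dx v).locallyIntegrable] with x hx
  refine ((hx 0).const_add (rep v 0)).congr_of_eventuallyEq (Eventually.of_forall fun y => ?_)
  simp only [← rep_sub_rep, add_sub_cancel]

theorem toH_injective : Function.Injective toH := by
  refine (injective_iff_map_eq_zero toHL).2 fun v (hv : toH v = 0) => ?_
  have hrep : 0 = rep v := eq_rep_of_ae_eq continuous_zero <| by
    rw [hv]; exact Lp.coeFn_zero ℝ 2 volume
  have hdx : dx v = 0 := by
    refine (Lp.eq_zero_iff_ae_eq_zero).2 ?_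
    filter_upwards [ae_hasDerivAt_rep v] with x hx
    rw [← hrep] at hx
    exact hx.unique (hasDerivAt_const x 0)
  exact norm_eq_zero.1 (pow_eq_zero_iff two_ne_zero |>.1 (by simp [V.norm_sq_eq, hv, hdx]))

theorem absolutelyContinuousOnInterval_rep_pow (v : V) (n : ℕ) (a b : ℝ) :
    AbsolutelyContinuousOnInterval (fun x => rep v x ^ n) a b := by
  have hconst (c : ℝ) : AbsolutelyContinuousOnInterval (fun _ => c) a b :=
    contDiffOn_const.absolutelyContinuousOnInterval
  have hrep : AbsolutelyContinuousOnInterval (rep v) a b := by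
    have := (hconst (rep v a)).fun_add <| ((dx v).intervalIntegrable a
      b).absolutelyContinuousOnInterval_intervalIntegral left_mem_uIcc
    simpa only [← rep_sub_rep, add_sub_cancel] using this
  induction n with
  | zero => simpa only [pow_zero] using hconst 1
  | succ n ih => simpa only [pow_succ] using ih.fun_mul hrep

theorem rep_pow_sub_rep_pow (v : V) (n : ℕ) (a b : ℝ) :
    rep v b ^ n - rep v a ^ n = ∫ x in a..b, n * toH v x ^ (n - 1) * dx v x := by
  rw [← (absolutelyContinuousOnInterval_rep_pow v n a b).integral_deriv_eq_sub]
  refine intervalIntegral.integral_congr_ae ?_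
  filter_upwards [ae_hasDerivAt_rep v, toH_ae_eq_rep v] with x hx hx' _
  rw [hx', (hx.fun_pow n).deriv]

theorem integrable_two_mul_toH_mul_dx (v : V) : Integrable fun x => 2 * toH v x * dx v x := by
  simpa only [mul_assoc] using ((toH v).integrable_mul_coe (dx v)).const_mul 2

theorem rep_sq_sub_rep_sq (v : V) (a b : ℝ) :
    rep v b ^ 2 - rep v a ^ 2 = ∫ x in a..b, 2 * toH v x * dx v x := by
  simpa only [Nat.cast_ofNat, Nat.add_one_sub_one, pow_one] using rep_pow_sub_rep_pow v 2 a b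

theorem tendsto_rep_sq_cocompact (v : V) : Tendsto (fun x => rep v x ^ 2) (cocompact ℝ) (𝓝 0) := by
  have hint : Integrable fun x => rep v x ^ 2 := by
    refine (toH v).integrable_sq.congr ?_
    filter_upwards [toH_ae_eq_rep v] with x hx
    rw [hx]
  exact tendsto_cocompact_zero_of_sub_eq_integral hint (integrable_two_mul_toH_mul_dx v)
    (rep_sq_sub_rep_sq v)

theorem tendsto_rep_cocompact (v : V) : Tendsto (rep v) (cocompact ℝ) (𝓝 0) := by
  have := (tendsto_rep_sq_cocompact v).sqrt
  simp only [Real.sqrt_sq_eq_abs, Real.sqrt_zero] at this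
  exact (tendsto_zero_iff_abs_tendsto_zero _).2 this

theorem rep_sq_eq_integral_Iic (v : V) (x : ℝ) :
    rep v x ^ 2 = ∫ s in Iic x, 2 * toH v s * dx v s := by
  have hlim := ((tendsto_rep_sq_cocompact v).mono_left atBot_le_cocompact).const_sub (rep v x ^ 2)
  simp only [rep_sq_sub_rep_sq, sub_zero] at hlim
  exact tendsto_nhds_unique hlim (intervalIntegral_tendsto_integral_Iic x
    (integrable_two_mul_toH_mul_dx v).integrableOn tendsto_id)

theorem abs_rep_le_norm (v : V) (x : ℝ) : |rep v x| ≤ ‖v‖ := by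
  refine abs_le_of_sq_le_sq ?_ (norm_nonneg v)
  have hint : Integrable fun s => toH v s ^ 2 + dx v s ^ 2 :=
    (toH v).integrable_sq.add (dx v).integrable_sq
  calc rep v x ^ 2 = ∫ s in Iic x, 2 * toH v s * dx v s := rep_sq_eq_integral_Iic v x
    _ ≤ ∫ s in Iic x, (toH v s ^ 2 + dx v s ^ 2) :=
      setIntegral_mono (integrable_two_mul_toH_mul_dx v).integrableOn hint.integrableOn
        fun s => two_mul_le_add_sq _ _
    _ ≤ ∫ s, (toH v s ^ 2 + dx v s ^ 2) :=
      setIntegral_le_integral hint <| Eventually.of_forall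
        fun s => add_nonneg (sq_nonneg _) (sq_nonneg _)
    _ = ‖v‖ ^ 2 := by
      rw [integral_add (toH v).integrable_sq (dx v).integrable_sq, ← H.norm_sq_eq_integral,
        ← H.norm_sq_eq_integral, ← V.norm_sq_eq]

theorem ae_abs_toH_le_norm (v : V) : ∀ᵐ x, |toH v x| ≤ ‖v‖ := by
  filter_upwards [toH_ae_eq_rep v] with x hx
  rw [hx]
  exact abs_rep_le_norm v x

theorem memLp_top_toH (v : V) : MemLp (toH v) ∞ :=
  memLp_top_of_bound (Lp.aestronglyMeasurable _) ‖v‖ (ae_abs_toH_le_norm v)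

theorem norm_toLp_top_toH_le (v : V) : ‖(memLp_top_toH v).toLp (toH v)‖ ≤ ‖v‖ := by
  rw [Lp.norm_toLp]
  refine ENNReal.toReal_le_of_le_ofReal (norm_nonneg v) ?_
  have hbound : ∀ᵐ x, ‖toH v x‖ ≤ ‖v‖ := ae_abs_toH_le_norm v
  simpa using eLpNorm_le_of_ae_bound (p := ∞) hbound

/-- The Sobolev embedding `V ↪ L^∞(ℝ)`. -/
noncomputable def toLinfL : V →L[ℝ] Lp ℝ ∞ (volume : Measure ℝ) :=
  LinearMap.mkContinuous
    { toFun := fun v => (memLp_top_toH v).toLp (toH v)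
      map_add' := fun v w => by
        rw [← MemLp.toLp_add]
        exact MemLp.toLp_congr _ _ (Lp.coeFn_add (toH v) (toH w))
      map_smul' := fun c v => by
        rw [RingHom.id_apply, ← MemLp.toLp_const_smul]
        exact MemLp.toLp_congr _ _ (Lp.coeFn_smul c (toH v)) }
    1 fun v => by rw [one_mul]; exact norm_toLp_top_toH_le v

/-- The convection term `v ∂ₓ v`, an element of `H` since `v` is bounded. -/
noncomputable def convection (v : V) : H :=
  (ContinuousLinearMap.mul ℝ ℝ).holderL volume ∞ 2 2 (toLinfL v) (dx v)

theorem continuous_convection : Continuous convection :=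
  ((ContinuousLinearMap.holderL volume ∞ 2 2 _).continuous.comp toLinfL.continuous).clm_apply
    dxL.continuous

theorem coeFn_convection (v : V) : ∀ᵐ x, convection v x = toH v x * dx v x := by
  filter_upwards [(ContinuousLinearMap.mul ℝ ℝ).coeFn_holder (r := 2) (toLinfL v) (dx v),
    (memLp_top_toH v).coeFn_toLp] with x hx hx'
  exact hx.trans (congrArg (· * dx v x) hx')

theorem norm_convection_le (v : V) : ‖convection v‖ ≤ ‖v‖ * ‖dx v‖ := by
  refine Lp.norm_le_mul_norm_of_ae_le_mul ?_
  filter_upwards [ae_abs_toH_le_norm v, coeFn_convection v] with x hx h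
  rw [h, norm_mul, Real.norm_eq_abs]
  gcongr

theorem inner_convection (v : V) (f : H) :
    inner ℝ (convection v) f = ∫ x, (toH v x * dx v x) * f x := by
  rw [H.inner_eq_integral]
  refine integral_congr_ae ?_
  filter_upwards [coeFn_convection v] with x hx
  rw [hx]

theorem inner_convection_toH (v : V) : inner ℝ (convection v) (toH v) = 0 := by
  have hint : Integrable fun x => convection v x * toH v x := H.integrable_mul_coe _ _
  have hcube (n : ℝ) : ∫ x in (-n)..n, convection v x * toH v x
      = (rep v n ^ 3 - rep v (-n) ^ 3) / 3 := by
    rw [rep_pow_sub_rep_pow, ← intervalIntegral.integral_div]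
    refine intervalIntegral.integral_congr_ae ?_
    filter_upwards [coeFn_convection v] with x hx _
    rw [hx]
    push_cast
    ring
  have htop := (tendsto_rep_cocompact v).mono_left atTop_le_cocompact
  have hbot := ((tendsto_rep_cocompact v).mono_left atBot_le_cocompact).comp
    tendsto_neg_atTop_atBot
  have hlim := ((htop.pow 3).sub (hbot.pow 3)).div_const 3
  rw [H.inner_eq_integral]
  refine tendsto_nhds_unique
    (intervalIntegral_tendsto_integral hint tendsto_neg_atTop_atBot tendsto_id) ?_
  simpa [hcube] using hlim

/-- The bilinear form `⟪v, w⟫_H + l ⟪∂ₓ v, ∂ₓ w⟫_H` of the operator `1 - l ∂ₓ²`. -/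
noncomputable def ellipticForm (l : ℝ) : V →L[ℝ] V →L[ℝ] ℝ :=
  (innerSL ℝ).bilinearComp toHL toHL + l • (innerSL ℝ).bilinearComp dxL dxL

theorem ellipticForm_apply (l : ℝ) (v w : V) :
    ellipticForm l v w = inner ℝ (toH v) (toH w) + l * inner ℝ (dx v) (dx w) := rfl

theorem isCoercive_ellipticForm {l : ℝ} (hl : 0 < l) : IsCoercive (ellipticForm l) := by
  refine ⟨min 1 l, lt_min one_pos hl, fun v => ?_⟩
  rw [ellipticForm_apply, real_inner_self_eq_norm_sq, real_inner_self_eq_norm_sq, mul_assoc, ← sq,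
    V.norm_sq_eq, mul_add]
  have h1 : min 1 l * ‖toH v‖ ^ 2 ≤ 1 * ‖toH v‖ ^ 2 := by gcongr; exact min_le_left 1 l
  have h2 : min 1 l * ‖dx v‖ ^ 2 ≤ l * ‖dx v‖ ^ 2 := by gcongr; exact min_le_right 1 l
  linarith

open Classical in
/-- The resolvent `(1 - l ∂ₓ²)⁻¹ : H → V`, given by the Lax–Milgram theorem for `0 < l`; it has the
junk value `0` where the elliptic form is not coercive. -/
noncomputable def laplaceResolvent (l : ℝ) : H →L[ℝ] V :=
  if h : IsCoercive (ellipticForm l) then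
    h.continuousLinearEquivOfBilin.symm.toContinuousLinearMap ∘L toHL.adjoint
  else 0

/-- The Yosida approximation `(1 - J) / l` of `-∂ₓ²`, where `J = (1 - l ∂ₓ²)⁻¹`. -/
noncomputable def yosida (l : ℝ) : H →L[ℝ] H :=
  l⁻¹ • (ContinuousLinearMap.id ℝ H - toHL ∘L laplaceResolvent l)

theorem yosida_apply (l : ℝ) (f : H) :
    yosida l f = l⁻¹ • (f - toH (laplaceResolvent l f)) := rfl

section Resolvent

variable {l : ℝ}

theorem ellipticForm_laplaceResolvent (hl : 0 < l) (f : H) (φ : V) :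
    ellipticForm l (laplaceResolvent l f) φ = inner ℝ f (toH φ) := by
  have hB := isCoercive_ellipticForm hl
  rw [laplaceResolvent, dif_pos hB, ← hB.continuousLinearEquivOfBilin_apply]
  simp [ContinuousLinearMap.adjoint_inner_left]

theorem inner_laplaceResolvent_left (hl : 0 < l) (f g : H) :
    inner ℝ (toH (laplaceResolvent l f)) g = inner ℝ f (toH (laplaceResolvent l g)) := by
  rw [← ellipticForm_laplaceResolvent hl f, real_inner_comm, ← ellipticForm_laplaceResolvent hl g,
    ellipticForm_apply, ellipticForm_apply, real_inner_comm,
    real_inner_comm (dx (laplaceResolvent l f))]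

theorem inner_toH_laplaceResolvent_nonneg (hl : 0 < l) (f : H) :
    0 ≤ inner ℝ f (toH (laplaceResolvent l f)) := by
  rw [← ellipticForm_laplaceResolvent hl, ellipticForm_apply, real_inner_self_eq_norm_sq,
    real_inner_self_eq_norm_sq]
  positivity

theorem norm_toH_laplaceResolvent_le (hl : 0 < l) (f : H) :
    ‖toH (laplaceResolvent l f)‖ ≤ ‖f‖ := by
  have hform := ellipticForm_laplaceResolvent hl f (laplaceResolvent l f)
  rw [ellipticForm_apply, real_inner_self_eq_norm_sq, real_inner_self_eq_norm_sq] at hform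
  have hle := real_inner_le_norm f (toH (laplaceResolvent l f))
  have : 0 ≤ l * ‖dx (laplaceResolvent l f)‖ ^ 2 := by positivity
  by_contra!
  nlinarith [norm_nonneg f]

theorem toH_sub_laplaceResolvent (hl : 0 < l) (f : H) :
    f - toH (laplaceResolvent l f) = l • yosida l f := by
  rw [yosida_apply, smul_inv_smul₀ hl.ne']

theorem inner_dx_laplaceResolvent (hl : 0 < l) (f : H) (φ : V) :
    inner ℝ (dx (laplaceResolvent l f)) (dx φ) = inner ℝ (yosida l f) (toH φ) := by
  rw [yosida_apply, real_inner_smul_left, inner_sub_left, ← ellipticForm_laplaceResolvent hl,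
    ellipticForm_apply, add_sub_cancel_left, inv_mul_cancel_left₀ hl.ne']

theorem inner_yosida_left (hl : 0 < l) (f g : H) :
    inner ℝ (yosida l f) g = inner ℝ f (yosida l g) := by
  rw [yosida_apply, yosida_apply, real_inner_smul_left, real_inner_smul_right, inner_sub_left,
    inner_sub_right, inner_laplaceResolvent_left hl]

theorem inner_laplaceResolvent_yosida (hl : 0 < l) (f g : H) :
    inner ℝ f (toH (laplaceResolvent l (yosida l g)))
      = inner ℝ (dx (laplaceResolvent l f)) (dx (laplaceResolvent l g)) := by
  rw [← inner_laplaceResolvent_left hl, real_inner_comm, ← inner_dx_laplaceResolvent hl,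
    real_inner_comm]

theorem inner_dx_laplaceResolvent_yosida (hl : 0 < l) (v : V) :
    inner ℝ (dx v) (dx (laplaceResolvent l (yosida l (toH v)))) = ‖yosida l (toH v)‖ ^ 2 := by
  rw [real_inner_comm, inner_dx_laplaceResolvent hl, inner_yosida_left hl,
    real_inner_self_eq_norm_sq]

theorem norm_sq_dx_laplaceResolvent_add (hl : 0 < l) (v : V) :
    ‖dx (laplaceResolvent l (toH v))‖ ^ 2 + l * ‖yosida l (toH v)‖ ^ 2
      = inner ℝ (dx (laplaceResolvent l (toH v))) (dx v) := by
  have hsplit : toH v = l • yosida l (toH v) + toH (laplaceResolvent l (toH v)) := by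
    rw [← toH_sub_laplaceResolvent hl, sub_add_cancel]
  calc ‖dx (laplaceResolvent l (toH v))‖ ^ 2 + l * ‖yosida l (toH v)‖ ^ 2
      = inner ℝ (yosida l (toH v)) (l • yosida l (toH v) + toH (laplaceResolvent l (toH v))) := by
        rw [inner_add_right, real_inner_smul_right, ← inner_dx_laplaceResolvent hl,
          real_inner_self_eq_norm_sq, real_inner_self_eq_norm_sq, add_comm]
    _ = inner ℝ (dx (laplaceResolvent l (toH v))) (dx v) := by
        rw [← hsplit, ← inner_dx_laplaceResolvent hl]

theorem norm_dx_laplaceResolvent_le (hl : 0 < l) (v : V) :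
    ‖dx (laplaceResolvent l (toH v))‖ ≤ ‖dx v‖ := by
  have hid := norm_sq_dx_laplaceResolvent_add hl v
  have hle := real_inner_le_norm (dx (laplaceResolvent l (toH v))) (dx v)
  have : 0 ≤ l * ‖yosida l (toH v)‖ ^ 2 := by positivity
  by_contra!
  nlinarith [norm_nonneg (dx v)]

theorem norm_laplaceResolvent_le (hl : 0 < l) (v : V) : ‖laplaceResolvent l (toH v)‖ ≤ ‖v‖ := by
  refine le_of_sq_le_sq ?_ (norm_nonneg v)
  rw [V.norm_sq_eq, V.norm_sq_eq v]
  gcongr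
  · exact norm_toH_laplaceResolvent_le hl (toH v)
  · exact norm_dx_laplaceResolvent_le hl v

theorem norm_sq_sub_laplaceResolvent_le (hl : 0 < l) (v : V) :
    ‖toH (laplaceResolvent l (toH v)) - toH v‖ ^ 2 ≤ l * ‖dx v‖ ^ 2 := by
  rw [norm_sub_rev, toH_sub_laplaceResolvent hl, norm_smul, mul_pow, Real.norm_eq_abs, sq_abs, sq l,
    mul_assoc]
  have hid := norm_sq_dx_laplaceResolvent_add hl v
  have hle := real_inner_le_norm (dx (laplaceResolvent l (toH v))) (dx v)
  have : l * ‖yosida l (toH v)‖ ^ 2 ≤ ‖dx v‖ ^ 2 := by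
    nlinarith [norm_dx_laplaceResolvent_le hl v, norm_nonneg (dx v),
      sq_nonneg ‖dx (laplaceResolvent l (toH v))‖]
  gcongr

end Resolvent

theorem tendsto_toH_laplaceResolvent (v : V) :
    Tendsto (fun l => toH (laplaceResolvent l (toH v))) (𝓝[>] 0) (𝓝 (toH v)) := by
  have hsq : Tendsto (fun l => ‖toH (laplaceResolvent l (toH v)) - toH v‖ ^ 2) (𝓝[>] 0) (𝓝 0) := by
    refine squeeze_zero' (Eventually.of_forall fun l => sq_nonneg _)
      (eventually_mem_nhdsWithin.mono fun l hl => norm_sq_sub_laplaceResolvent_le hl v) ?_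
    have hlim : Tendsto (fun l : ℝ => l * ‖dx v‖ ^ 2) (𝓝 0) (𝓝 (0 * ‖dx v‖ ^ 2)) :=
      tendsto_id.mul_const _
    rw [zero_mul] at hlim
    exact hlim.mono_left nhdsWithin_le_nhds
  rw [tendsto_iff_norm_sub_tendsto_zero]
  simpa using hsq.sqrt

theorem dense_range_adjoint_toHL : DenseRange toHL.adjoint := by
  suffices (toHL.adjoint.range).topologicalClosure = ⊤ from
    Submodule.dense_iff_topologicalClosure_eq_top.2 this
  refine Submodule.topologicalClosure_eq_top_iff.2 <| (Submodule.eq_bot_iff _).2 fun v hv => ?_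
  have h0 := (Submodule.mem_orthogonal _ v).1 hv (toHL.adjoint (toH v)) ⟨_, rfl⟩
  rw [ContinuousLinearMap.adjoint_inner_left, toHL_apply, inner_self_eq_zero] at h0
  exact toH_injective h0

theorem tendsto_inner_of_dense {E ι : Type*} [NormedAddCommGroup E] [InnerProductSpace ℝ E]
    {L : Filter ι} {x : ι → E} {x₀ : E} {s : Set E} {M : ℝ} (hs : Dense s)
    (hM : ∀ᶠ i in L, ‖x i - x₀‖ ≤ M)
    (h : ∀ w ∈ s, Tendsto (fun i => inner ℝ w (x i)) L (𝓝 (inner ℝ w x₀))) (w : E) :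
    Tendsto (fun i => inner ℝ w (x i)) L (𝓝 (inner ℝ w x₀)) := by
  rw [Metric.tendsto_nhds]
  intro ε hε
  obtain ⟨w', hw's, hw'⟩ := hs.exists_dist_lt w (ε := ε / (2 * (|M| + 1))) (by positivity)
  filter_upwards [hM, Metric.tendsto_nhds.1 (h w' hw's) (ε / 2) (half_pos hε)] with i hi hi'
  rw [Real.dist_eq, ← inner_sub_right] at hi' ⊢
  rw [dist_eq_norm] at hw'
  calc |inner ℝ w (x i - x₀)|
      = |inner ℝ (w - w') (x i - x₀) + inner ℝ w' (x i - x₀)| := by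
        rw [← inner_add_left, sub_add_cancel]
    _ ≤ ‖w - w'‖ * ‖x i - x₀‖ + |inner ℝ w' (x i - x₀)| :=
        (abs_add_le _ _).trans (by gcongr; exact abs_real_inner_le_norm _ _)
    _ < ε / (2 * (|M| + 1)) * (|M| + 1) + ε / 2 := by
        refine add_lt_add_of_le_of_lt ?_ hi'
        gcongr
        linarith [le_abs_self M]
    _ = ε := by field_simp; ring

theorem tendsto_inner_laplaceResolvent (v w : V) :
    Tendsto (fun l => inner ℝ w (laplaceResolvent l (toH v))) (𝓝[>] 0) (𝓝 (inner ℝ w v)) := by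
  refine tendsto_inner_of_dense dense_range_adjoint_toHL (M := ‖v‖ + ‖v‖)
    (eventually_mem_nhdsWithin.mono fun l hl => ?_) ?_ w
  · exact norm_sub_le_of_le (norm_laplaceResolvent_le hl v) le_rfl
  · rintro _ ⟨f, rfl⟩
    simp only [ContinuousLinearMap.adjoint_inner_left, toHL_apply]
    exact tendsto_const_nhds.inner (tendsto_toH_laplaceResolvent v)

theorem tendsto_apply_laplaceResolvent (L : VDual) (v : V) :
    Tendsto (fun l => L (laplaceResolvent l (toH v))) (𝓝[>] 0) (𝓝 (L v)) := by
  simpa only [InnerProductSpace.toDual_symm_apply] using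
    tendsto_inner_laplaceResolvent v ((InnerProductSpace.toDual ℝ V).symm L)

theorem tendsto_inner_dx_laplaceResolvent (v : V) :
    Tendsto (fun l => inner ℝ (dx v) (dx (laplaceResolvent l (toH v)))) (𝓝[>] 0)
      (𝓝 (‖dx v‖ ^ 2)) := by
  rw [← real_inner_self_eq_norm_sq]
  exact tendsto_apply_laplaceResolvent (innerSL ℝ (dx v) ∘L dxL) v

theorem norm_sq_dx_le_of_laplaceResolvent {v : V} {M : ℝ}
    (hM : ∀ l > 0, ‖dx (laplaceResolvent l (toH v))‖ ^ 2 ≤ M) : ‖dx v‖ ^ 2 ≤ M := by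
  suffices ‖dx v‖ ^ 2 ≤ (‖dx v‖ ^ 2 + M) / 2 by linarith
  refine le_of_tendsto (tendsto_inner_dx_laplaceResolvent v)
    (eventually_mem_nhdsWithin.mono fun l hl => ?_)
  have hle := real_inner_le_norm (dx v) (dx (laplaceResolvent l (toH v)))
  linarith [hM l hl, two_mul_le_add_sq ‖dx v‖ ‖dx (laplaceResolvent l (toH v))‖]

section AbsoluteContinuity

theorem absolutelyContinuousOnInterval_of_dist_le {X Y : Type*} [PseudoMetricSpace X]
    [PseudoMetricSpace Y] {f : ℝ → X} {g : ℝ → Y} {a b C : ℝ}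
    (hg : AbsolutelyContinuousOnInterval g a b)
    (h : ∀ s ∈ uIcc a b, ∀ t ∈ uIcc a b, dist (f s) (f t) ≤ C * dist (g s) (g t)) :
    AbsolutelyContinuousOnInterval f a b := by
  refine squeeze_zero' (Eventually.of_forall fun E => Finset.sum_nonneg fun i _ => dist_nonneg) ?_
    (by simpa only [mul_zero] using Tendsto.const_mul C hg)
  filter_upwards [mem_inf_of_right (mem_principal_self _)] with E hE
  rw [Finset.mul_sum]
  refine Finset.sum_le_sum fun i hi => h _ ?_ _ ?_
  · exact (hE.1 i hi).1
  · exact (hE.1 i hi).2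

theorem absolutelyContinuousOnInterval_comp_of_contDiff {φ f : ℝ → ℝ} {a b : ℝ}
    (hφ : ContDiff ℝ 1 φ) (hf : AbsolutelyContinuousOnInterval f a b) :
    AbsolutelyContinuousOnInterval (fun t => φ (f t)) a b := by
  obtain ⟨M, hM⟩ := hf.exists_bound
  obtain ⟨C, hC⟩ := hφ.contDiffOn.exists_lipschitzOnWith one_ne_zero (convex_Icc (-M) M)
    isCompact_Icc
  exact absolutelyContinuousOnInterval_of_dist_le hf fun s hs t ht =>
    hC.dist_le_mul _ (abs_le.1 (hM s hs)) _ (abs_le.1 (hM t ht))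

theorem le_of_ae_hasDerivAt_nonpos {f f' : ℝ → ℝ} {a b : ℝ} (hab : a ≤ b)
    (hf : AbsolutelyContinuousOnInterval f a b)
    (hderiv : ∀ᵐ t, t ∈ Ioc a b → HasDerivAt f (f' t) t ∧ f' t ≤ 0) : f b ≤ f a := by
  rw [← sub_nonpos, ← hf.integral_deriv_eq_sub]
  rw [intervalIntegral.integral_of_le hab]
  refine setIntegral_nonpos_of_ae_restrict ?_
  rw [EventuallyLE, ae_restrict_iff' measurableSet_Ioc]
  filter_upwards [hderiv] with t ht htI
  rw [(ht htI).1.deriv]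
  exact (ht htI).2

theorem add_integral_mul_le_mul_exp_integral {β X : ℝ → ℝ} {a b K : ℝ} (hab : a ≤ b)
    (hβ : IntervalIntegrable β volume a b)
    (hβX : IntervalIntegrable (fun t => β t * X t) volume a b)
    (hβ_nonneg : ∀ᵐ t, t ∈ Ioc a b → 0 ≤ β t)
    (hX : ∀ᵐ t, t ∈ Ioc a b → X t ≤ K + ∫ s in a..t, β s * X s) :
    K + ∫ s in a..b, β s * X s ≤ K * Real.exp (∫ s in a..b, β s) := by
  set p : ℝ → ℝ := fun t => ∫ s in a..t, β s
  set g : ℝ → ℝ := fun t => K + ∫ s in a..t, β s * X s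
  have hE : AbsolutelyContinuousOnInterval (fun t => Real.exp (-p t)) a b :=
    absolutelyContinuousOnInterval_comp_of_contDiff (φ := fun x => Real.exp (-x)) (by fun_prop)
      (hβ.absolutelyContinuousOnInterval_intervalIntegral left_mem_uIcc)
  have hg : AbsolutelyContinuousOnInterval g a b :=
    contDiffOn_const.absolutelyContinuousOnInterval.fun_add
      (hβX.absolutelyContinuousOnInterval_intervalIntegral left_mem_uIcc)
  have hle : g b * Real.exp (-p b) ≤ g a * Real.exp (-p a) := by
    refine le_of_ae_hasDerivAt_nonpos hab (hg.fun_mul hE)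
      (f' := fun t => β t * Real.exp (-p t) * (X t - g t)) ?_
    filter_upwards [hβ.ae_hasDerivAt_integral, hβX.ae_hasDerivAt_integral, hβ_nonneg, hX]
      with t hp' hg' hβt hXt ht
    have htI : t ∈ uIcc a b := by
      rw [uIcc_of_le hab]
      exact Ioc_subset_Icc_self ht
    refine ⟨?_, mul_nonpos_of_nonneg_of_nonpos (by have := hβt ht; positivity)
      (sub_nonpos.2 (hXt ht))⟩
    exact (((hg' htI a left_mem_uIcc).const_add K).fun_mul
      (hp' htI a left_mem_uIcc).fun_neg.exp).congr_deriv (by ring)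
  have hpa : p a = 0 := intervalIntegral.integral_same
  have hga : g a = K := by simp [g]
  rwa [hpa, hga, neg_zero, Real.exp_zero, mul_one, Real.exp_neg, mul_inv_le_iff₀ (Real.exp_pos _)]
    at hle

end AbsoluteContinuity

section Energy

variable {E F : Type*} [NormedAddCommGroup E] [InnerProductSpace ℝ E] [NormedAddCommGroup F]
  [NormedSpace ℝ F]

variable {ι : F →L[ℝ] E} {z : ℝ → E} {dz : ℝ → F →L[ℝ] ℝ} {B : E →L[ℝ] F}

theorem inner_map_sub_inner_map_eq_apply {s t : ℝ}
    (hderiv : ∀ φ, inner ℝ (z t) (ι φ) - inner ℝ (z s) (ι φ) = (∫ r in s..t, dz r) φ)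
    (hB : ∀ f g, inner ℝ f (ι (B g)) = inner ℝ (ι (B f)) g) :
    inner ℝ (z t) (ι (B (z t))) - inner ℝ (z s) (ι (B (z s)))
      = (∫ r in s..t, dz r) (B (z t + z s)) := by
  have hsymm : inner ℝ (z t) (ι (B (z s))) = inner ℝ (z s) (ι (B (z t))) := by
    rw [hB, real_inner_comm]
  rw [← hderiv]
  simp only [map_add, inner_add_right, hsymm]
  ring

variable {a b : ℝ}

theorem absolutelyContinuousOnInterval_inner_map (hz : ContinuousOn z (uIcc a b))
    (hdz : IntervalIntegrable dz volume a b)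
    (hderiv : ∀ φ, ∀ s ∈ uIcc a b, ∀ t ∈ uIcc a b,
      inner ℝ (z t) (ι φ) - inner ℝ (z s) (ι φ) = (∫ r in s..t, dz r) φ)
    (hB : ∀ f g, inner ℝ f (ι (B g)) = inner ℝ (ι (B f)) g) :
    AbsolutelyContinuousOnInterval (fun t => inner ℝ (z t) (ι (B (z t)))) a b := by
  obtain ⟨M, hM⟩ := isCompact_uIcc.exists_bound_of_continuousOn (B.continuous.comp_continuousOn hz)
  have hint {t : ℝ} (ht : t ∈ uIcc a b) : IntervalIntegrable (fun r => ‖dz r‖) volume a t :=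
    hdz.norm.mono_set (uIcc_subset_uIcc_left ht)
  refine absolutelyContinuousOnInterval_of_dist_le (C := 2 * M)
    (hdz.norm.absolutelyContinuousOnInterval_intervalIntegral left_mem_uIcc) fun s hs t ht => ?_
  have hBle : ‖B (z s + z t)‖ ≤ 2 * M := by
    rw [map_add, two_mul]
    exact norm_add_le_of_le (hM s hs) (hM t ht)
  rw [dist_eq_norm, dist_eq_norm, inner_map_sub_inner_map_eq_apply (hderiv · t ht s hs) hB,
    intervalIntegral.integral_interval_sub_left (hint hs) (hint ht), mul_comm]
  exact ContinuousLinearMap.le_of_opNorm_le_of_le _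
    intervalIntegral.norm_integral_le_abs_integral_norm hBle

theorem ae_hasDerivAt_inner_map (hz : ContinuousOn z (uIcc a b))
    (hdz : IntervalIntegrable dz volume a b)
    (hderiv : ∀ φ, ∀ s ∈ uIcc a b, ∀ t ∈ uIcc a b,
      inner ℝ (z t) (ι φ) - inner ℝ (z s) (ι φ) = (∫ r in s..t, dz r) φ)
    (hB : ∀ f g, inner ℝ f (ι (B g)) = inner ℝ (ι (B f)) g) :
    ∀ᵐ t, t ∈ uIoo a b →
      HasDerivAt (fun t => inner ℝ (z t) (ι (B (z t)))) (2 * dz t (B (z t))) t := by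
  filter_upwards [hdz.ae_hasDerivAt_integral] with t hY ht
  have htI : t ∈ uIcc a b := uIoo_subset_uIcc_self ht
  have hnhds : uIcc a b ∈ 𝓝 t := mem_of_superset (isOpen_Ioo.mem_nhds ht) uIoo_subset_uIcc_self
  have hsum : Tendsto (fun s => B (z s + z t)) (𝓝[≠] t) (𝓝 (B (z t + z t))) :=
    (B.continuous.tendsto _).comp <|
      ((hz.continuousAt hnhds).tendsto.mono_left nhdsWithin_le_nhds).add_const (z t)
  have hslope : Tendsto (slope (fun s => ∫ r in t..s, dz r) t) (𝓝[≠] t) (𝓝 (dz t)) :=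
    hasDerivAt_iff_tendsto_slope.1 (hY htI t htI)
  have hlim := (isBoundedBilinearMap_apply.continuous.tendsto _).comp (hslope.prodMk_nhds hsum)
  simp only [← two_smul ℝ (z t), map_smul, smul_eq_mul] at hlim
  rw [hasDerivAt_iff_tendsto_slope]
  refine hlim.congr' ?_
  filter_upwards [mem_nhdsWithin_of_mem_nhds hnhds] with s hs
  rw [slope_def_module, inner_map_sub_inner_map_eq_apply (hderiv · t htI s hs) hB,
    Function.comp_apply, slope_def_module, intervalIntegral.integral_same, sub_zero]
  rfl

theorem inner_map_sub_inner_map_eq_integral (hz : ContinuousOn z (uIcc a b))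
    (hdz : IntervalIntegrable dz volume a b)
    (hderiv : ∀ φ, ∀ s ∈ uIcc a b, ∀ t ∈ uIcc a b,
      inner ℝ (z t) (ι φ) - inner ℝ (z s) (ι φ) = (∫ r in s..t, dz r) φ)
    (hB : ∀ f g, inner ℝ f (ι (B g)) = inner ℝ (ι (B f)) g) :
    inner ℝ (z b) (ι (B (z b))) - inner ℝ (z a) (ι (B (z a)))
      = 2 * ∫ t in a..b, dz t (B (z t)) := by
  rw [← (absolutelyContinuousOnInterval_inner_map hz hdz hderiv hB).integral_deriv_eq_sub,
    ← intervalIntegral.integral_const_mul]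
  refine intervalIntegral.integral_congr_ae ?_
  filter_upwards [ae_hasDerivAt_inner_map hz hdz hderiv hB, Measure.ae_ne volume (max a b)]
    with t hderiv ht_ne ht
  exact (hderiv ⟨ht.1, ht.2.lt_of_ne ht_ne⟩).deriv

end Energy

theorem IsWeakDeriv.indicator {U : Set ℝ} {f g : ℝ → ℝ} (h : IsWeakDeriv U f g) :
    IsWeakDeriv U (U.indicator f) (U.indicator g) := by
  have integral_indicator_mul (k ψ : ℝ → ℝ) (hψ : tsupport ψ ⊆ U) :
      ∫ x, U.indicator k x * ψ x = ∫ x, k x * ψ x := by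
    congr with x
    by_cases hx : x ∈ U
    · rw [indicator_of_mem hx]
    · rw [image_eq_zero_of_notMem_tsupport (mt (@hψ x) hx), mul_zero, mul_zero]
  intro φ hφ hφc hφU
  rw [integral_indicator_mul f _ (tsupport_deriv_subset.trans hφU), integral_indicator_mul g _ hφU]
  exact h φ hφ hφc hφU

theorem IsWeakDeriv.sub_eq_integral {a b : ℝ} (hab : a ≠ b) {f df F : ℝ → ℝ}
    (h : IsWeakDeriv (Ioo a b) f df) (hf : IntegrableOn f (Ioo a b))
    (hdf : IntegrableOn df (Ioo a b)) (hF : ContinuousOn F (Icc a b))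
    (hFf : ∀ᵐ t ∂volume.restrict (Ioo a b), F t = f t) {s t : ℝ}
    (hs : s ∈ Icc a b) (ht : t ∈ Icc a b) : F t - F s = ∫ r in s..t, df r := by
  set g := (Ioo a b).indicator df
  have hg : Integrable g := hdf.integrable_indicator measurableSet_Ioo
  obtain ⟨c, hc⟩ := h.indicator.exists_eq_add_integral isOpen_Ioo
    (hf.integrable_indicator measurableSet_Ioo).locallyIntegrable hg.locallyIntegrable a
  have hprim : Continuous fun x => c + ∫ r in a..x, g r :=
    (intervalIntegral.continuous_primitive (fun _ _ => hg.intervalIntegrable) a).const_add c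
  have hEq : EqOn F (fun x => c + ∫ r in a..x, g r) (Icc a b) := by
    refine Measure.eqOn_Icc_of_ae_eq volume hab ?_ hF hprim.continuousOn
    rw [← Measure.restrict_congr_set Ioo_ae_eq_Icc]
    filter_upwards [hFf, ae_restrict_of_ae hc, ae_restrict_mem measurableSet_Ioo] with x hFx hx hxI
    rw [hFx, ← hx hxI, indicator_of_mem hxI]
  rw [hEq hs, hEq ht, add_sub_add_left_eq_sub, intervalIntegral.integral_interval_sub_left
    hg.intervalIntegrable hg.intervalIntegrable]
  refine intervalIntegral.integral_congr_ae ?_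
  filter_upwards [Measure.ae_ne volume a, Measure.ae_ne volume b] with x hxa hxb hx
  have hxI : x ∈ Icc a b := ordConnected_Icc.uIcc_subset hs ht (uIoc_subset_uIcc hx)
  exact indicator_of_mem (s := Ioo a b) ⟨hxI.1.lt_of_ne hxa.symm, hxI.2.lt_of_ne hxb⟩ _

section TimeMeasure

variable {E : Type*} [NormedAddCommGroup E] {T : ℝ}

theorem timeMeasure_eq_Ioc (T : ℝ) : timeMeasure T = volume.restrict (Ioc 0 T) :=
  Measure.restrict_congr_set Ioo_ae_eq_Ioc

instance (T : ℝ) : IsFiniteMeasure (timeMeasure T) :=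
  inferInstanceAs (IsFiniteMeasure (volume.restrict (Ioo 0 T)))

theorem ae_timeMeasure_iff {p : ℝ → Prop} :
    (∀ᵐ t ∂timeMeasure T, p t) ↔ ∀ᵐ t, t ∈ Ioc 0 T → p t := by
  rw [timeMeasure_eq_Ioc, ae_restrict_iff' measurableSet_Ioc]

theorem integral_timeMeasure [NormedSpace ℝ E] (hT : 0 ≤ T) (f : ℝ → E) :
    ∫ t, f t ∂timeMeasure T = ∫ t in 0..T, f t := by
  rw [timeMeasure_eq_Ioc, intervalIntegral.integral_of_le hT]

theorem integrable_timeMeasure_iff (hT : 0 ≤ T) {f : ℝ → E} :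
    Integrable f (timeMeasure T) ↔ IntervalIntegrable f volume 0 T := by
  rw [timeMeasure_eq_Ioc, intervalIntegrable_iff_integrableOn_Ioc_of_le hT, IntegrableOn]

theorem normL2_sq {f : ℝ → E} (hf : MemLp f 2 (timeMeasure T)) :
    normL2 T f ^ 2 = ∫ t, ‖f t‖ ^ 2 ∂timeMeasure T := by
  have hint : 0 ≤ ∫ t, ‖f t‖ ^ 2 ∂timeMeasure T := integral_nonneg fun _ => sq_nonneg _
  rw [normL2, hf.eLpNorm_eq_integral_rpow_norm two_ne_zero ENNReal.ofNat_ne_top]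
  simp only [ENNReal.toReal_ofNat, Real.rpow_two]
  rw [ENNReal.toReal_ofReal (by positivity), ← Real.rpow_mul_natCast hint]
  norm_num

theorem normLinf_le {M : ℝ} {f : ℝ → E} (hM : 0 ≤ M) (h : ∀ᵐ t ∂timeMeasure T, ‖f t‖ ≤ M) :
    normLinf T f ≤ M := by
  rw [normLinf, eLpNorm_exponent_top]
  exact ENNReal.toReal_le_of_le_ofReal hM (eLpNormEssSup_le_of_ae_bound h)

theorem ae_norm_le_normLinf {f : ℝ → E} (hf : MemLp f ∞ (timeMeasure T)) :
    ∀ᵐ t ∂timeMeasure T, ‖f t‖ ≤ normLinf T f := by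
  filter_upwards [ae_le_eLpNormEssSup (f := f) (μ := timeMeasure T)] with t ht
  rw [← eLpNorm_exponent_top] at ht
  have ht' := ENNReal.toReal_mono hf.eLpNorm_ne_top ht
  rwa [toReal_enorm] at ht'

theorem timeMeasure_mono {t : ℝ} (ht : t ≤ T) : timeMeasure t ≤ timeMeasure T :=
  Measure.restrict_mono (Ioo_subset_Ioo_right ht) le_rfl

theorem ae_timeMeasure_of_le {t : ℝ} (ht : t ≤ T) {p : ℝ → Prop}
    (h : ∀ᵐ r ∂timeMeasure T, p r) : ∀ᵐ r ∂timeMeasure t, p r :=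
  ae_mono (timeMeasure_mono ht) h

theorem ae_mem_Ioo_timeMeasure (T : ℝ) : ∀ᵐ t ∂timeMeasure T, t ∈ Ioo 0 T :=
  ae_restrict_mem measurableSet_Ioo

theorem integral_timeMeasure_mono {t : ℝ} (ht : t ≤ T) {f : ℝ → ℝ} (hf : ∀ t, 0 ≤ f t)
    (hfi : Integrable f (timeMeasure T)) : ∫ r, f r ∂timeMeasure t ≤ ∫ r, f r ∂timeMeasure T :=
  integral_mono_measure (timeMeasure_mono ht) (Eventually.of_forall hf) hfi

theorem ae_le_mul_exp_of_le_add_integral {β X : ℝ → ℝ} {K : ℝ} (hK : 0 ≤ K)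
    (hβ_nonneg : ∀ t, 0 ≤ β t) (hβ : Integrable β (timeMeasure T))
    (hβX : Integrable (fun t => β t * X t) (timeMeasure T))
    (hX : ∀ᵐ t ∂timeMeasure T, X t ≤ K + ∫ s, β s * X s ∂timeMeasure t) :
    ∀ᵐ t ∂timeMeasure T, X t ≤ K * Real.exp (∫ s, β s ∂timeMeasure T) := by
  filter_upwards [hX, ae_mem_Ioo_timeMeasure T] with t hXt ht
  have hle : timeMeasure t ≤ timeMeasure T := timeMeasure_mono ht.2.le
  have hXs : ∀ᵐ s, s ∈ Ioc 0 t → X s ≤ K + ∫ r in 0..s, β r * X r := by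
    filter_upwards [ae_timeMeasure_iff.1 (ae_timeMeasure_of_le ht.2.le hX)] with s hs hst
    rw [← integral_timeMeasure hst.1.le]
    exact hs hst
  calc X t ≤ K + ∫ s in 0..t, β s * X s := hXt.trans_eq (by rw [integral_timeMeasure ht.1.le])
    _ ≤ K * Real.exp (∫ s in 0..t, β s) :=
        add_integral_mul_le_mul_exp_integral ht.1.le
          ((integrable_timeMeasure_iff ht.1.le).1 (hβ.mono_measure hle))
          ((integrable_timeMeasure_iff ht.1.le).1 (hβX.mono_measure hle))
          (Eventually.of_forall fun s _ => hβ_nonneg s) hXs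
    _ ≤ K * Real.exp (∫ s, β s ∂timeMeasure T) := by
        rw [← integral_timeMeasure ht.1.le]
        exact mul_le_mul_of_nonneg_left
          (Real.exp_le_exp.2 (integral_timeMeasure_mono ht.2.le hβ_nonneg hβ)) hK

end TimeMeasure

namespace MemW

variable {T : ℝ} {y : ℝ → V} {dy : ℝ → VDual} {z : ℝ → H}

theorem memLp_toH (h : MemW T y dy) : MemLp (fun t => toH (y t)) 2 (timeMeasure T) :=
  toHL.comp_memLp' h.memLp

theorem memLp_dx (h : MemW T y dy) : MemLp (fun t => dx (y t)) 2 (timeMeasure T) :=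
  dxL.comp_memLp' h.memLp

theorem inner_sub_inner_eq (h : MemW T y dy) (hT : 0 < T) (hz : ContinuousOn z (Icc 0 T))
    (hzy : ∀ᵐ t ∂timeMeasure T, z t = toH (y t)) (φ : V) {s t : ℝ} (hs : s ∈ Icc 0 T)
    (ht : t ∈ Icc 0 T) :
    inner ℝ (z t) (toH φ) - inner ℝ (z s) (toH φ) = (∫ r in s..t, dy r) φ := by
  have hdy : Integrable dy (timeMeasure T) := h.memLp_deriv.integrable one_le_two
  have hsub : uIcc s t ⊆ uIcc 0 T := by
    rw [uIcc_of_le hT.le]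
    exact ordConnected_Icc.uIcc_subset hs ht
  rw [ContinuousLinearMap.intervalIntegral_apply
    (((integrable_timeMeasure_iff hT.le).1 hdy).mono_set hsub)]
  refine (h.weakDeriv φ).sub_eq_integral hT.ne ?_ (hdy.apply_continuousLinearMap φ)
    (F := fun t => inner ℝ (z t) (toH φ)) (hz.inner continuousOn_const) ?_ hs ht
  · exact (h.memLp_toH.integrable one_le_two).inner_const (𝕜 := ℝ) (toH φ)
  · filter_upwards [hzy] with t ht
    rw [ht]

theorem inner_map_sub_inner_map_eq_integral (h : MemW T y dy) (hT : 0 < T)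
    (hz : ContinuousOn z (Icc 0 T)) (hzy : ∀ᵐ t ∂timeMeasure T, z t = toH (y t)) {B : H →L[ℝ] V}
    (hB : ∀ f g, inner ℝ f (toH (B g)) = inner ℝ (toH (B f)) g) {t : ℝ} (ht : t ∈ Icc 0 T) :
    inner ℝ (z t) (toH (B (z t))) - inner ℝ (z 0) (toH (B (z 0)))
      = 2 * ∫ r, dy r (B (toH (y r))) ∂timeMeasure t := by
  have hsub : uIcc 0 t ⊆ Icc 0 T := ordConnected_Icc.uIcc_subset (left_mem_Icc.2 hT.le) ht
  have hdy : Integrable dy (timeMeasure t) :=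
    (h.memLp_deriv.integrable one_le_two).mono_measure (timeMeasure_mono ht.2)
  have henergy := Burgers.inner_map_sub_inner_map_eq_integral (ι := toHL) (hz.mono hsub)
    ((integrable_timeMeasure_iff ht.1).1 hdy)
    (fun φ s hs t ht => h.inner_sub_inner_eq hT hz hzy φ (hsub hs) (hsub ht)) hB
  simp only [toHL_apply] at henergy
  rw [henergy, ← integral_timeMeasure ht.1]
  congr 1
  refine integral_congr_ae ?_
  filter_upwards [ae_timeMeasure_of_le ht.2 hzy] with r hr
  rw [hr]

theorem tendsto_inner_laplaceResolvent (h : MemW T y dy) (hT : 0 < T)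
    (hz : ContinuousOn z (Icc 0 T)) (hzy : ∀ᵐ t ∂timeMeasure T, z t = toH (y t)) {y0 : V}
    (hz0 : z 0 = toH y0) {t : ℝ} (ht : t ∈ Icc 0 T) :
    Tendsto (fun l => inner ℝ (z t) (toH (laplaceResolvent l (z t)))) (𝓝[>] 0)
      (𝓝 (‖toH y0‖ ^ 2 + 2 * ∫ r, dy r (y r) ∂timeMeasure t)) := by
  have hle : timeMeasure t ≤ timeMeasure T := timeMeasure_mono ht.2
  have hint : Tendsto (fun l => ∫ r, dy r (laplaceResolvent l (toH (y r))) ∂timeMeasure t) (𝓝[>] 0)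
      (𝓝 (∫ r, dy r (y r) ∂timeMeasure t)) := by
    refine tendsto_integral_filter_of_dominated_convergence (fun r => ‖dy r‖ * ‖y r‖) ?_ ?_
      ((h.memLp_deriv.norm.integrable_mul h.memLp.norm).mono_measure hle)
      (Eventually.of_forall fun r => tendsto_apply_laplaceResolvent (dy r) (y r))
    · refine Eventually.of_forall fun l =>
        isBoundedBilinearMap_apply.continuous.comp_aestronglyMeasurable₂
          (h.memLp_deriv.1.mono_measure hle)
          ((laplaceResolvent l).continuous.comp_aestronglyMeasurable
            (h.memLp_toH.1.mono_measure hle))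
    · filter_upwards [self_mem_nhdsWithin] with l hl
      exact Eventually.of_forall fun r =>
        (dy r).le_opNorm_of_le (norm_laplaceResolvent_le hl (y r))
  have hinit : Tendsto (fun l => inner ℝ (toH y0) (toH (laplaceResolvent l (toH y0)))) (𝓝[>] 0)
      (𝓝 (‖toH y0‖ ^ 2)) := by
    rw [← real_inner_self_eq_norm_sq]
    exact tendsto_const_nhds.inner (tendsto_toH_laplaceResolvent y0)
  refine (hinit.add (hint.const_mul 2)).congr' ?_
  filter_upwards [self_mem_nhdsWithin] with l hl
  rw [← h.inner_map_sub_inner_map_eq_integral hT hz hzy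
    (fun f g => (inner_laplaceResolvent_left hl f g).symm) ht, hz0, add_sub_cancel]

theorem norm_sq_toH_eq (h : MemW T y dy) (hT : 0 < T) (hz : ContinuousOn z (Icc 0 T))
    (hzy : ∀ᵐ t ∂timeMeasure T, z t = toH (y t)) {y0 : V} (hz0 : z 0 = toH y0) :
    ∀ᵐ t ∂timeMeasure T,
      ‖toH (y t)‖ ^ 2 = ‖toH y0‖ ^ 2 + 2 * ∫ r, dy r (y r) ∂timeMeasure t := by
  filter_upwards [hzy, ae_mem_Ioo_timeMeasure T] with t hzt ht
  refine tendsto_nhds_unique ?_ (h.tendsto_inner_laplaceResolvent hT hz hzy hz0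
    (Ioo_subset_Icc_self ht))
  rw [hzt, ← real_inner_self_eq_norm_sq]
  exact tendsto_const_nhds.inner (tendsto_toH_laplaceResolvent (y t))

theorem norm_sq_add_integral_nonneg (h : MemW T y dy) (hT : 0 < T) (hz : ContinuousOn z (Icc 0 T))
    (hzy : ∀ᵐ t ∂timeMeasure T, z t = toH (y t)) {y0 : V} (hz0 : z 0 = toH y0) :
    0 ≤ ‖toH y0‖ ^ 2 + 2 * ∫ r, dy r (y r) ∂timeMeasure T := by
  refine ge_of_tendsto (h.tendsto_inner_laplaceResolvent hT hz hzy hz0 (right_mem_Icc.2 hT.le)) ?_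
  filter_upwards [self_mem_nhdsWithin] with l hl
  exact inner_toH_laplaceResolvent_nonneg hl (z T)

end MemW

theorem MemW.integrable_apply {T : ℝ} {y : ℝ → V} {dy : ℝ → VDual} (h : MemW T y dy)
    (B : V →L[ℝ] V) : Integrable (fun t => dy t (B (y t))) (timeMeasure T) := by
  rw [← memLp_one_iff_integrable]
  exact (ContinuousLinearMap.id ℝ VDual).memLp_of_bilin 1 h.memLp_deriv (B.comp_memLp' h.memLp)

/-- The weak solutions `y` of the heat equation `∂ₜ y = ν ∂ₓ² y + g` with source `g ∈ L²(0,T;H)` and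
initial value `y0`; `z` is the representative of `y` in `C([0,T]; H)` and `dy = ∂ₜ y`. -/
structure IsHeatSolution (ν T : ℝ) (g : ℝ → H) (y0 : V) (y : ℝ → V) (dy : ℝ → VDual)
    (z : ℝ → H) : Prop where
  memLp_source : MemLp g 2 (timeMeasure T)
  memW : MemW T y dy
  continuousOn : ContinuousOn z (Icc 0 T)
  ae_eq : ∀ᵐ t ∂timeMeasure T, z t = toH (y t)
  initial : z 0 = toH y0
  equation : ∀ᵐ t ∂timeMeasure T, ∀ φ : V,
    dy t φ = inner ℝ (g t) (toH φ) - ν * inner ℝ (dx (y t)) (dx φ)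

theorem two_mul_inner_sub_inner_dx_le {ν l : ℝ} (hν : 0 < ν) (hl : 0 < l) (f : H) (v : V) :
    2 * (inner ℝ f (toH (laplaceResolvent l (yosida l (toH v))))
      - ν * inner ℝ (dx v) (dx (laplaceResolvent l (yosida l (toH v))))) ≤ ‖f‖ ^ 2 / (2 * ν) := by
  rw [inner_dx_laplaceResolvent_yosida hl]
  set w := yosida l (toH v)
  have hinner : inner ℝ f (toH (laplaceResolvent l w)) ≤ ‖f‖ * ‖w‖ :=
    (real_inner_le_norm _ _).trans (by gcongr; exact norm_toH_laplaceResolvent_le hl w)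
  have hsq : ‖f‖ ^ 2 / (2 * ν) - 2 * (‖f‖ * ‖w‖ - ν * ‖w‖ ^ 2)
      = (‖f‖ - 2 * ν * ‖w‖) ^ 2 / (2 * ν) := by
    field_simp
    ring
  have : 0 ≤ (‖f‖ - 2 * ν * ‖w‖) ^ 2 / (2 * ν) := by positivity
  linarith

namespace IsHeatSolution

variable {ν T : ℝ} {g : ℝ → H} {y0 : V} {y : ℝ → V} {dy : ℝ → VDual} {z : ℝ → H}

theorem inner_laplaceResolvent_yosida_le (h : IsHeatSolution ν T g y0 y dy z) (hT : 0 < T)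
    (hν : 0 < ν) {l : ℝ} (hl : 0 < l) {t : ℝ} (ht : t ∈ Icc 0 T) :
    inner ℝ (z t) (toH (laplaceResolvent l (yosida l (z t))))
      ≤ ‖dx y0‖ ^ 2 + (∫ r, ‖g r‖ ^ 2 ∂timeMeasure t) / (2 * ν) := by
  have hle : timeMeasure t ≤ timeMeasure T := timeMeasure_mono ht.2
  have henergy := h.memW.inner_map_sub_inner_map_eq_integral hT h.continuousOn h.ae_eq
    (B := laplaceResolvent l ∘L yosida l) (fun f g => by
      simp only [ContinuousLinearMap.comp_apply]
      rw [inner_laplaceResolvent_yosida hl, real_inner_comm,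
        ← inner_laplaceResolvent_yosida hl, real_inner_comm]) ht
  have hsource : 2 * ∫ r, dy r (laplaceResolvent l (yosida l (toH (y r)))) ∂timeMeasure t
      ≤ ∫ r, ‖g r‖ ^ 2 / (2 * ν) ∂timeMeasure t := by
    rw [← integral_const_mul]
    refine integral_mono_ae (((h.memW.integrable_apply
        (laplaceResolvent l ∘L yosida l ∘L toHL)).mono_measure hle).const_mul 2)
      (((h.memLp_source.integrable_norm_pow two_ne_zero).mono_measure hle).div_const _) ?_
    filter_upwards [ae_timeMeasure_of_le ht.2 h.equation] with r hr
    rw [hr]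
    exact two_mul_inner_sub_inner_dx_le hν hl (g r) (y r)
  simp only [ContinuousLinearMap.comp_apply, h.initial] at henergy
  rw [inner_laplaceResolvent_yosida hl (toH y0), real_inner_self_eq_norm_sq] at henergy
  have hinit : ‖dx (laplaceResolvent l (toH y0))‖ ^ 2 ≤ ‖dx y0‖ ^ 2 := by
    gcongr
    exact norm_dx_laplaceResolvent_le hl y0
  rw [← integral_div]
  linarith

theorem norm_sq_dx_le (h : IsHeatSolution ν T g y0 y dy z) (hT : 0 < T) (hν : 0 < ν) :
    ∀ᵐ t ∂timeMeasure T,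
      ‖dx (y t)‖ ^ 2 ≤ ‖dx y0‖ ^ 2 + (∫ r, ‖g r‖ ^ 2 ∂timeMeasure t) / (2 * ν) := by
  filter_upwards [h.ae_eq, ae_mem_Ioo_timeMeasure T] with t hzt ht
  refine norm_sq_dx_le_of_laplaceResolvent fun l hl => ?_
  have hle := h.inner_laplaceResolvent_yosida_le hT hν hl (Ioo_subset_Icc_self ht)
  rwa [inner_laplaceResolvent_yosida hl, real_inner_self_eq_norm_sq, hzt] at hle

theorem norm_deriv_le (h : IsHeatSolution ν T g y0 y dy z) (hν : 0 ≤ ν) :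
    ∀ᵐ t ∂timeMeasure T, ‖dy t‖ ≤ ‖g t‖ + ν * ‖dx (y t)‖ := by
  filter_upwards [h.equation] with t ht
  refine (dy t).opNorm_le_bound (by positivity) fun φ => ?_
  have hg : |inner ℝ (g t) (toH φ)| ≤ ‖g t‖ * ‖φ‖ :=
    (abs_real_inner_le_norm _ _).trans (by gcongr; exact norm_toH_le φ)
  have hdx : |inner ℝ (dx (y t)) (dx φ)| ≤ ‖dx (y t)‖ * ‖φ‖ :=
    (abs_real_inner_le_norm _ _).trans (by gcongr; exact norm_dx_le φ)
  calc ‖dy t φ‖ ≤ |inner ℝ (g t) (toH φ)| + |ν * inner ℝ (dx (y t)) (dx φ)| := by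
        rw [ht, Real.norm_eq_abs]
        exact abs_sub _ _
    _ ≤ ‖g t‖ * ‖φ‖ + ν * (‖dx (y t)‖ * ‖φ‖) := by
        rw [abs_mul, abs_of_nonneg hν]
        gcongr
    _ = (‖g t‖ + ν * ‖dx (y t)‖) * ‖φ‖ := by ring

end IsHeatSolution

/-- The weak solutions `y ∈ W(V) ∩ L^∞(0,T;V)` of the viscous Burgers equation
`∂ₜ y + y ∂ₓ y = ν ∂ₓ² y + f` with forcing `f ∈ L²(0,T;H)`, as solutions of the heat equation with
source `f - y ∂ₓ y`. -/
structure IsBurgersSolution (ν T : ℝ) (f : ℝ → H) (y0 : V) (y : ℝ → V) (dy : ℝ → VDual)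
    (z : ℝ → H) : Prop where
  memLp_force : MemLp f 2 (timeMeasure T)
  memLinf : MemLp y ∞ (timeMeasure T)
  isHeatSolution : IsHeatSolution ν T (fun t => f t - convection (y t)) y0 y dy z

theorem WeakBurgers.ae_forall {ν T : ℝ} {χ u : ℝ → ℝ} {y : ℝ → V} {dy : ℝ → VDual}
    (h : WeakBurgers ν T χ u y dy) (hχ : MemLp χ 2 volume) :
    ∀ᵐ t ∂timeMeasure T, ∀ φ : V,
      dy t φ = inner ℝ (u t • hχ.toLp χ - convection (y t)) (toH φ)
        - ν * inner ℝ (dx (y t)) (dx φ) := by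
  have hdense : ∀ᵐ t ∂timeMeasure T, ∀ n : ℕ, dy t (TopologicalSpace.denseSeq V n) =
      inner ℝ (u t • hχ.toLp χ - convection (y t)) (toH (TopologicalSpace.denseSeq V n))
        - ν * inner ℝ (dx (y t)) (dx (TopologicalSpace.denseSeq V n)) := by
    refine ae_all_iff.2 fun n => ?_
    filter_upwards [h (TopologicalSpace.denseSeq V n)] with t ht
    have hforce (φ : V) : ∫ x, (χ x * u t) * toH φ x = inner ℝ (u t • hχ.toLp χ) (toH φ) := by
      rw [real_inner_smul_left, real_inner_comm, H.inner_toLp, ← integral_const_mul]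
      exact integral_congr_ae (Eventually.of_forall fun x => by ring)
    rw [hforce, ← inner_convection] at ht
    rw [inner_sub_left]
    linarith
  filter_upwards [hdense] with t ht φ
  have hcont : Continuous fun φ : V => inner ℝ (u t • hχ.toLp χ - convection (y t)) (toHL φ)
      - ν * inner ℝ (dx (y t)) (dxL φ) := by fun_prop
  exact congrFun (Continuous.ext_on (TopologicalSpace.denseRange_denseSeq V) (dy t).continuous
    hcont (forall_mem_range.2 ht)) φ

theorem MemW.memLp_convection {T : ℝ} {y : ℝ → V} {dy : ℝ → VDual} (h : MemW T y dy)
    (hy : MemLp y ∞ (timeMeasure T)) :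
    MemLp (fun t => convection (y t)) 2 (timeMeasure T) := by
  refine h.memLp_dx.of_le_mul (c := normLinf T y)
    (continuous_convection.comp_aestronglyMeasurable hy.1) ?_
  filter_upwards [ae_norm_le_normLinf hy] with t ht
  exact (norm_convection_le (y t)).trans (by gcongr)

theorem WeakBurgers.exists_isBurgersSolution {ν T : ℝ} {χ u : ℝ → ℝ} {y0 : V} {y : ℝ → V}
    {dy : ℝ → VDual} (h : WeakBurgers ν T χ u y dy) (hχ : MemLp χ 2 volume)
    (hu : MemLp u 2 (timeMeasure T)) (hW : MemW T y dy) (hy : MemLp y ∞ (timeMeasure T))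
    (hinit : HasInitialValue T y y0) :
    ∃ z, IsBurgersSolution ν T (fun t => u t • hχ.toLp χ) y0 y dy z := by
  obtain ⟨z, hz, hzy, hz0⟩ := hinit
  have hf : MemLp (fun t => u t • hχ.toLp χ) 2 (timeMeasure T) :=
    ((ContinuousLinearMap.id ℝ ℝ).smulRight (hχ.toLp χ)).comp_memLp' hu
  exact ⟨z, hf, hy, hf.sub (hW.memLp_convection hy), hW, hz, hzy, ext_inner_right ℝ hz0,
    h.ae_forall hχ⟩

section NormL2

variable {T : ℝ} {E F G : Type*} [NormedAddCommGroup E] [NormedAddCommGroup F]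
  [NormedAddCommGroup G]

theorem normL2_nonneg (T : ℝ) (f : ℝ → E) : 0 ≤ normL2 T f := ENNReal.toReal_nonneg

theorem normL2_const_mul (c : ℝ) (u : ℝ → ℝ) : normL2 T (fun t => c * u t) = |c| * normL2 T u := by
  have hnorm := eLpNorm_const_smul c u 2 (timeMeasure T)
  rw [normL2, normL2, ← Real.norm_eq_abs, ← toReal_enorm, ← ENNReal.toReal_mul, ← hnorm]
  rfl

theorem normL2_norm (f : ℝ → E) : normL2 T (fun t => ‖f t‖) = normL2 T f := by
  rw [normL2, eLpNorm_norm, normL2]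

theorem normL2_le_add_mul {w : ℝ → E} {f : ℝ → F} {y : ℝ → G} {c : ℝ} (hc : 0 ≤ c)
    (hf : MemLp f 2 (timeMeasure T)) (hy : MemLp y 2 (timeMeasure T))
    (h : ∀ᵐ t ∂timeMeasure T, ‖w t‖ ≤ ‖f t‖ + c * ‖y t‖) :
    normL2 T w ≤ normL2 T f + c * normL2 T y := by
  have hcy : MemLp (fun t => c * ‖y t‖) 2 (timeMeasure T) := hy.norm.const_mul c
  have hle : eLpNorm w 2 (timeMeasure T)
      ≤ eLpNorm (fun t => ‖f t‖) 2 (timeMeasure T)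
        + eLpNorm (fun t => c * ‖y t‖) 2 (timeMeasure T) :=
    (eLpNorm_mono_ae_real h).trans (eLpNorm_add_le hf.norm.1 hcy.1 one_le_two)
  calc normL2 T w ≤ normL2 T (fun t => ‖f t‖) + normL2 T (fun t => c * ‖y t‖) :=
        (ENNReal.toReal_mono (ENNReal.add_ne_top.2 ⟨hf.norm.2.ne, hcy.2.ne⟩) hle).trans
          ENNReal.toReal_add_le
    _ = normL2 T f + c * normL2 T y := by
        rw [normL2_const_mul, abs_of_nonneg hc, normL2_norm, normL2_norm]

theorem normW_le_add (T : ℝ) (y : ℝ → V) (dy : ℝ → VDual) :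
    normW T y dy ≤ normL2 T y + normL2 T dy := by
  have h₁ := normL2_nonneg T y
  have h₂ := normL2_nonneg T dy
  rw [normW]
  refine Real.sqrt_le_left (by positivity) |>.2 ?_
  nlinarith [mul_nonneg h₁ h₂]

end NormL2

/-- The constant `K` of the energy estimate `∫ ‖y‖²_V dt ≤ K (‖f‖²_{L²(0,T;H)} + ‖y₀‖²_H)` for the
Burgers equation with forcing `f`. -/
noncomputable def energyConst (ν T : ℝ) : ℝ := T * Real.exp T + (1 + T * Real.exp T) / (2 * ν)

theorem energyConst_pos {ν T : ℝ} (hν : 0 < ν) (hT : 0 < T) : 0 < energyConst ν T := by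
  rw [energyConst]
  positivity

namespace IsBurgersSolution

variable {ν T : ℝ} {f : ℝ → H} {y0 : V} {y : ℝ → V} {dy : ℝ → VDual} {z : ℝ → H}

theorem memW (h : IsBurgersSolution ν T f y0 y dy z) : MemW T y dy := h.isHeatSolution.memW

theorem two_mul_apply_add_le (h : IsBurgersSolution ν T f y0 y dy z) :
    ∀ᵐ t ∂timeMeasure T,
      2 * dy t (y t) + 2 * ν * ‖dx (y t)‖ ^ 2 ≤ ‖f t‖ ^ 2 + ‖toH (y t)‖ ^ 2 := by
  filter_upwards [h.isHeatSolution.equation] with t ht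
  rw [ht, inner_sub_left, inner_convection_toH, real_inner_self_eq_norm_sq]
  linarith [real_inner_le_norm (f t) (toH (y t)), two_mul_le_add_sq ‖f t‖ ‖toH (y t)‖]

theorem two_mul_integral_apply_add_le (h : IsBurgersSolution ν T f y0 y dy z) {t : ℝ}
    (ht : t ≤ T) :
    2 * ∫ r, dy r (y r) ∂timeMeasure t + 2 * ν * ∫ r, ‖dx (y r)‖ ^ 2 ∂timeMeasure t
      ≤ normL2 T f ^ 2 + ∫ r, ‖toH (y r)‖ ^ 2 ∂timeMeasure t := by
  have hle : timeMeasure t ≤ timeMeasure T := timeMeasure_mono ht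
  have hdy := (h.memW.integrable_apply (ContinuousLinearMap.id ℝ V)).mono_measure hle
  have hdx := (h.memW.memLp_dx.integrable_norm_pow two_ne_zero).mono_measure hle
  have hf := h.memLp_force.integrable_norm_pow two_ne_zero
  have hy := (h.memW.memLp_toH.integrable_norm_pow two_ne_zero).mono_measure hle
  have hint := integral_mono_ae ((hdy.const_mul 2).add (hdx.const_mul (2 * ν)))
    ((hf.mono_measure hle).add hy) (ae_timeMeasure_of_le ht h.two_mul_apply_add_le)
  simp only [ContinuousLinearMap.id_apply] at hint hdy
  rw [integral_add' (hdy.const_mul 2) (hdx.const_mul (2 * ν)),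
    integral_add' (hf.mono_measure hle) hy, integral_const_mul, integral_const_mul] at hint
  rw [normL2_sq h.memLp_force]
  linarith [integral_timeMeasure_mono ht (fun _ => sq_nonneg _) hf]

theorem norm_sq_toH_le (h : IsBurgersSolution ν T f y0 y dy z) (hT : 0 < T) (hν : 0 ≤ ν) :
    ∀ᵐ t ∂timeMeasure T,
      ‖toH (y t)‖ ^ 2 ≤ (normL2 T f ^ 2 + ‖toH y0‖ ^ 2) * Real.exp T := by
  have hint := h.memW.memLp_toH.integrable_norm_pow two_ne_zero
  have hX : ∀ᵐ t ∂timeMeasure T, ‖toH (y t)‖ ^ 2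
      ≤ normL2 T f ^ 2 + ‖toH y0‖ ^ 2 + ∫ s, 1 * ‖toH (y s)‖ ^ 2 ∂timeMeasure t := by
    filter_upwards [h.memW.norm_sq_toH_eq hT h.isHeatSolution.continuousOn h.isHeatSolution.ae_eq
      h.isHeatSolution.initial, ae_mem_Ioo_timeMeasure T] with t ht htT
    have hdx : 0 ≤ 2 * ν * ∫ r, ‖dx (y r)‖ ^ 2 ∂timeMeasure t :=
      mul_nonneg (by positivity) (integral_nonneg fun _ => sq_nonneg _)
    simp only [one_mul]
    linarith [h.two_mul_integral_apply_add_le htT.2.le]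
  have hexp : ∫ _, (1 : ℝ) ∂timeMeasure T = T := by
    rw [integral_timeMeasure hT.le, intervalIntegral.integral_const, smul_eq_mul, mul_one, sub_zero]
  simpa only [hexp] using ae_le_mul_exp_of_le_add_integral (β := fun _ => 1) (by positivity)
    (fun _ => zero_le_one) (integrable_const 1) (by simpa only [one_mul] using hint) hX

theorem integral_norm_sq_toH_le (h : IsBurgersSolution ν T f y0 y dy z) (hT : 0 < T)
    (hν : 0 ≤ ν) :
    ∫ t, ‖toH (y t)‖ ^ 2 ∂timeMeasure T
      ≤ T * Real.exp T * (normL2 T f ^ 2 + ‖toH y0‖ ^ 2) := by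
  refine (integral_mono_ae (h.memW.memLp_toH.integrable_norm_pow two_ne_zero)
    (integrable_const _) (h.norm_sq_toH_le hT hν)).trans_eq ?_
  rw [integral_timeMeasure hT.le, intervalIntegral.integral_const, smul_eq_mul, sub_zero]
  ring

theorem integral_norm_sq_dx_le (h : IsBurgersSolution ν T f y0 y dy z) (hT : 0 < T)
    (hν : 0 < ν) :
    ∫ t, ‖dx (y t)‖ ^ 2 ∂timeMeasure T
      ≤ (1 + T * Real.exp T) / (2 * ν) * (normL2 T f ^ 2 + ‖toH y0‖ ^ 2) := by
  have hend := h.memW.norm_sq_add_integral_nonneg hT h.isHeatSolution.continuousOn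
    h.isHeatSolution.ae_eq h.isHeatSolution.initial
  rw [div_mul_eq_mul_div, le_div_iff₀ (by positivity)]
  linarith [h.two_mul_integral_apply_add_le le_rfl, h.integral_norm_sq_toH_le hT hν.le]

theorem integral_norm_sq_le (h : IsBurgersSolution ν T f y0 y dy z) (hT : 0 < T) (hν : 0 < ν) :
    ∫ t, ‖y t‖ ^ 2 ∂timeMeasure T ≤ energyConst ν T * (normL2 T f ^ 2 + ‖toH y0‖ ^ 2) := by
  simp only [V.norm_sq_eq (y _)]
  rw [integral_add (h.memW.memLp_toH.integrable_norm_pow two_ne_zero)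
    (h.memW.memLp_dx.integrable_norm_pow two_ne_zero), energyConst, add_mul]
  exact add_le_add (h.integral_norm_sq_toH_le hT hν.le) (h.integral_norm_sq_dx_le hT hν)

theorem integrable_mul_norm_sq_dx (h : IsBurgersSolution ν T f y0 y dy z) :
    Integrable (fun t => ‖y t‖ ^ 2 * ‖dx (y t)‖ ^ 2) (timeMeasure T) := by
  refine ((h.memW.memLp_dx.integrable_norm_pow two_ne_zero).const_mul (normLinf T y ^ 2)).mono'
    ((h.memLinf.1.norm.pow 2).mul (h.memW.memLp_dx.1.norm.pow 2)) ?_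
  filter_upwards [ae_norm_le_normLinf h.memLinf] with t ht
  rw [Real.norm_eq_abs, abs_of_nonneg (by positivity)]
  gcongr

theorem integral_norm_sq_source_le (h : IsBurgersSolution ν T f y0 y dy z) {t : ℝ} (ht : t ≤ T) :
    ∫ r, ‖f r - convection (y r)‖ ^ 2 ∂timeMeasure t
      ≤ 2 * normL2 T f ^ 2 + 2 * ∫ r, ‖y r‖ ^ 2 * ‖dx (y r)‖ ^ 2 ∂timeMeasure t := by
  have hle : timeMeasure t ≤ timeMeasure T := timeMeasure_mono ht
  have hf := h.memLp_force.integrable_norm_pow two_ne_zero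
  have hpoint (r : ℝ) : ‖f r - convection (y r)‖ ^ 2
      ≤ 2 * ‖f r‖ ^ 2 + 2 * (‖y r‖ ^ 2 * ‖dx (y r)‖ ^ 2) := by
    calc ‖f r - convection (y r)‖ ^ 2 ≤ (‖f r‖ + ‖y r‖ * ‖dx (y r)‖) ^ 2 := by
          gcongr
          exact norm_sub_le_of_le le_rfl (norm_convection_le (y r))
      _ ≤ 2 * (‖f r‖ ^ 2 + (‖y r‖ * ‖dx (y r)‖) ^ 2) := add_sq_le
      _ = 2 * ‖f r‖ ^ 2 + 2 * (‖y r‖ ^ 2 * ‖dx (y r)‖ ^ 2) := by ring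
  have hint := integral_mono
    ((h.isHeatSolution.memLp_source.integrable_norm_pow two_ne_zero).mono_measure hle)
    (((hf.mono_measure hle).const_mul 2).add
      ((h.integrable_mul_norm_sq_dx.mono_measure hle).const_mul 2)) hpoint
  rw [integral_add' ((hf.mono_measure hle).const_mul 2)
    ((h.integrable_mul_norm_sq_dx.mono_measure hle).const_mul 2), integral_const_mul,
    integral_const_mul] at hint
  rw [normL2_sq h.memLp_force]
  linarith [integral_timeMeasure_mono ht (fun _ => sq_nonneg _) hf]

theorem norm_sq_dx_le (h : IsBurgersSolution ν T f y0 y dy z) (hT : 0 < T) (hν : 0 < ν) :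
    ∀ᵐ t ∂timeMeasure T, ‖dx (y t)‖ ^ 2 ≤ (‖dx y0‖ ^ 2 + normL2 T f ^ 2 / ν)
      * Real.exp (energyConst ν T / ν * (normL2 T f ^ 2 + ‖toH y0‖ ^ 2)) := by
  have hX : ∀ᵐ t ∂timeMeasure T, ‖dx (y t)‖ ^ 2 ≤ ‖dx y0‖ ^ 2 + normL2 T f ^ 2 / ν
      + ∫ s, ‖y s‖ ^ 2 / ν * ‖dx (y s)‖ ^ 2 ∂timeMeasure t := by
    filter_upwards [h.isHeatSolution.norm_sq_dx_le hT hν, ae_mem_Ioo_timeMeasure T] with t ht htT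
    simp only [div_mul_eq_mul_div]
    rw [integral_div, add_assoc, ← add_div]
    refine ht.trans (add_le_add_right ?_ _)
    rw [div_le_div_iff₀ (by positivity) hν]
    nlinarith [h.integral_norm_sq_source_le htT.2.le]
  filter_upwards [ae_le_mul_exp_of_le_add_integral (by positivity) (fun t => by positivity)
    ((h.memW.memLp.integrable_norm_pow two_ne_zero).div_const ν)
    (by simpa only [div_mul_eq_mul_div] using h.integrable_mul_norm_sq_dx.div_const ν) hX]
    with t ht
  refine ht.trans ?_
  rw [integral_div, div_mul_eq_mul_div]
  gcongr
  exact h.integral_norm_sq_le hT hν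

theorem norm_sq_le (h : IsBurgersSolution ν T f y0 y dy z) (hT : 0 < T) (hν : 0 < ν) :
    ∀ᵐ t ∂timeMeasure T, ‖y t‖ ^ 2 ≤ (Real.exp T + 1 + 1 / ν) * (normL2 T f + ‖y0‖) ^ 2
      * Real.exp (energyConst ν T / ν * (normL2 T f ^ 2 + ‖toH y0‖ ^ 2)) := by
  have hK := energyConst_pos hν hT
  have hV : normL2 T f ^ 2 + ‖y0‖ ^ 2 ≤ (normL2 T f + ‖y0‖) ^ 2 := by
    linarith [add_sq (normL2 T f) ‖y0‖, mul_nonneg (normL2_nonneg T f) (norm_nonneg y0)]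
  set n := normL2 T f
  set D := n + ‖y0‖
  set X := Real.exp (energyConst ν T / ν * (n ^ 2 + ‖toH y0‖ ^ 2))
  have hX : 1 ≤ X := Real.one_le_exp (by positivity)
  have hn : n ^ 2 ≤ D ^ 2 := by linarith [sq_nonneg ‖y0‖]
  have hy0 := V.norm_sq_eq y0
  have hdx0 : ‖dx y0‖ ^ 2 ≤ D ^ 2 := by linarith [sq_nonneg ‖toH y0‖, sq_nonneg n]
  have hS : n ^ 2 + ‖toH y0‖ ^ 2 ≤ D ^ 2 := by linarith [sq_nonneg ‖dx y0‖]
  filter_upwards [h.norm_sq_toH_le hT hν.le, h.norm_sq_dx_le hT hν] with t hH hdx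
  calc ‖y t‖ ^ 2 = 1 * ‖toH (y t)‖ ^ 2 + ‖dx (y t)‖ ^ 2 := by rw [one_mul, V.norm_sq_eq]
    _ ≤ X * (D ^ 2 * Real.exp T) + (D ^ 2 + D ^ 2 / ν) * X := by
        refine add_le_add (mul_le_mul hX (hH.trans ?_) (by positivity) (by positivity))
          (hdx.trans ?_)
        · gcongr
        · gcongr ?_ * _
          exact add_le_add hdx0 (by gcongr)
    _ = (Real.exp T + 1 + 1 / ν) * D ^ 2 * X := by ring

theorem normLinf_le (h : IsBurgersSolution ν T f y0 y dy z) (hT : 0 < T) (hν : 0 < ν) :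
    normLinf T y ≤ √(Real.exp T + 1 + 1 / ν) * (normL2 T f + ‖y0‖)
      * Real.exp (energyConst ν T / (2 * ν) * (normL2 T f ^ 2 + ‖toH y0‖ ^ 2)) := by
  have hn := normL2_nonneg T f
  refine Burgers.normLinf_le (by positivity) ?_
  filter_upwards [h.norm_sq_le hT hν] with t ht
  refine le_of_sq_le_sq (ht.trans_eq ?_) (by positivity)
  rw [mul_pow, mul_pow, Real.sq_sqrt (by positivity), ← Real.exp_nat_mul]
  congr 2
  push_cast
  field_simp

theorem normL2_le (h : IsBurgersSolution ν T f y0 y dy z) (hT : 0 < T) (hν : 0 < ν) :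
    normL2 T y ≤ √(energyConst ν T) * √(normL2 T f ^ 2 + ‖toH y0‖ ^ 2) := by
  rw [← Real.sqrt_mul (energyConst_pos hν hT).le]
  refine Real.le_sqrt_of_sq_le ?_
  rw [normL2_sq h.memW.memLp]
  exact h.integral_norm_sq_le hT hν

theorem normL2_deriv_le (h : IsBurgersSolution ν T f y0 y dy z) (hν : 0 ≤ ν) :
    normL2 T dy ≤ normL2 T f + (normLinf T y + ν) * normL2 T y := by
  have hM : 0 ≤ normLinf T y := ENNReal.toReal_nonneg
  refine normL2_le_add_mul (by positivity) h.memLp_force h.memW.memLp ?_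
  filter_upwards [h.isHeatSolution.norm_deriv_le hν, ae_norm_le_normLinf h.memLinf] with t ht hMt
  calc ‖dy t‖ ≤ ‖f t - convection (y t)‖ + ν * ‖dx (y t)‖ := ht
    _ ≤ ‖f t‖ + ‖y t‖ * ‖dx (y t)‖ + ν * ‖dx (y t)‖ := by
        gcongr
        exact norm_sub_le_of_le le_rfl (norm_convection_le (y t))
    _ ≤ ‖f t‖ + normLinf T y * ‖y t‖ + ν * ‖y t‖ := by
        gcongr <;> exact norm_dx_le (y t)
    _ = ‖f t‖ + (normLinf T y + ν) * ‖y t‖ := by ring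

end IsBurgersSolution

theorem sqrt_le_exp {x : ℝ} (hx : 0 ≤ x) : √x ≤ Real.exp x :=
  (Real.sqrt_le_left (by positivity)).2 <| by
    nlinarith [Real.add_one_le_exp x]

theorem mul_mul_exp_le_Cstate {c k C : ℝ} (hC : 0 ≤ C) (hc : c ≤ C) (hk : k ≤ C) (T : ℝ)
    (u : ℝ → ℝ) (y0 : V) :
    c * (normL2 T u + ‖y0‖) * Real.exp (k * (normL2 T u ^ 2 + ‖toH y0‖ ^ 2)) ≤ Cstate C T u y0 := by
  have hn := normL2_nonneg T u
  rw [Cstate]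
  gcongr

theorem Cstate_norm_smul_le {C : ℝ} (hC : 0 ≤ C) (T : ℝ) (χ : H) (u : ℝ → ℝ) (y0 : V) :
    Cstate C T (fun t => ‖u t • χ‖) y0 ≤ Cstate (C * (1 + ‖χ‖ ^ 2)) T u y0 := by
  have hn := normL2_nonneg T u
  have hχ : ‖χ‖ ≤ 1 + ‖χ‖ ^ 2 := by nlinarith [sq_nonneg (‖χ‖ - 1)]
  have hnorm : normL2 T (fun t => ‖u t • χ‖) = ‖χ‖ * normL2 T u := by
    simp only [norm_smul, mul_comm ‖u _‖]
    rw [← normL2_norm u, normL2_const_mul, abs_norm]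
  rw [Cstate, Cstate, hnorm, mul_assoc C (1 + _) (_ + _), mul_assoc C (1 + _) (_ + _)]
  gcongr
  · nlinarith [norm_nonneg y0, sq_nonneg ‖χ‖]
  · nlinarith [mul_nonneg (sq_nonneg ‖χ‖) (sq_nonneg ‖toH y0‖), sq_nonneg (normL2 T u)]

theorem add_mul_le_mul_exp {M L n D S a b k ν : ℝ} (ha : 0 ≤ a) (hb : 0 ≤ b) (hk : 0 ≤ k)
    (hν : 0 ≤ ν) (hS : 0 ≤ S) (hL_nonneg : 0 ≤ L) (hM : M ≤ a * D * Real.exp (k * S))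
    (hL : L ≤ b * √S) (hn : n ≤ D) (hSD : √S ≤ D) :
    M + (L + (n + (M + ν) * L))
      ≤ ((a + 1) * (b + 1) + ν * b) * D * Real.exp ((k + 1) * S) := by
  have hD : 0 ≤ D := (Real.sqrt_nonneg S).trans hSD
  set E := Real.exp ((k + 1) * S)
  have hE : Real.exp (k * S) * Real.exp S = E := by rw [← Real.exp_add, ← add_one_mul]
  have hkE : Real.exp (k * S) ≤ E :=
    Real.exp_le_exp.2 (by gcongr; exact le_add_of_nonneg_right one_pos.le)
  have hE1 : 1 ≤ E := Real.one_le_exp (by positivity)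
  have hprod : M * L ≤ a * D * b * E := by
    calc M * L ≤ (a * D * Real.exp (k * S)) * (b * Real.exp S) :=
          mul_le_mul hM (hL.trans (by gcongr; exact sqrt_le_exp hS)) hL_nonneg (by positivity)
      _ = a * D * b * E := by rw [← hE]; ring
  have hLE : L ≤ b * D * E :=
    (hL.trans (by gcongr)).trans (le_mul_of_one_le_right (by positivity) hE1)
  calc M + (L + (n + (M + ν) * L)) = M + L + n + M * L + ν * L := by ring
    _ ≤ a * D * E + b * D * E + D * E + a * D * b * E + ν * (b * D * E) := by
        gcongr
        · exact hM.trans (by gcongr)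
        · exact hn.trans (le_mul_of_one_le_right hD hE1)
    _ = ((a + 1) * (b + 1) + ν * b) * D * E := by ring

/-- The constant `C` of the state estimate for the Burgers equation with forcing `f`, as a function
of `ν` and `T` only. -/
noncomputable def stateConst (ν T : ℝ) : ℝ :=
  (√(Real.exp T + 1 + 1 / ν) + 1) * (√(energyConst ν T) + 1) + ν * √(energyConst ν T)
    + (energyConst ν T / (2 * ν) + 1) + energyConst ν T

theorem stateConst_pos {ν T : ℝ} (hν : 0 < ν) (hT : 0 < T) : 0 < stateConst ν T := by
  have hK := energyConst_pos hν hT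
  rw [stateConst]
  positivity

theorem sqrt_add_sq_le_add (n : ℝ) (hn : 0 ≤ n) (v : V) : √(n ^ 2 + ‖toH v‖ ^ 2) ≤ n + ‖v‖ := by
  refine (Real.sqrt_le_left (by positivity)).2 ?_
  nlinarith [V.norm_sq_eq v, sq_nonneg ‖dx v‖, mul_nonneg hn (norm_nonneg v)]

namespace IsBurgersSolution

variable {ν T : ℝ} {f : ℝ → H} {y0 : V} {y : ℝ → V} {dy : ℝ → VDual} {z : ℝ → H}

theorem normLinf_add_normW_le (h : IsBurgersSolution ν T f y0 y dy z) (hT : 0 < T)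
    (hν : 0 < ν) :
    normLinf T y + normW T y dy ≤ Cstate (stateConst ν T) T (fun t => ‖f t‖) y0 := by
  have hK := energyConst_pos hν hT
  have hn := normL2_nonneg T f
  calc normLinf T y + normW T y dy
      ≤ normLinf T y + (normL2 T y + (normL2 T f + (normLinf T y + ν) * normL2 T y)) := by
        gcongr
        exact (normW_le_add T y dy).trans (by gcongr; exact h.normL2_deriv_le hν.le)
    _ ≤ ((√(Real.exp T + 1 + 1 / ν) + 1) * (√(energyConst ν T) + 1) + ν * √(energyConst ν T))
          * (normL2 T f + ‖y0‖)
          * Real.exp ((energyConst ν T / (2 * ν) + 1) * (normL2 T f ^ 2 + ‖toH y0‖ ^ 2)) :=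
        add_mul_le_mul_exp (by positivity) (by positivity) (by positivity) hν.le (by positivity)
          (normL2_nonneg T y) (h.normLinf_le hT hν) (h.normL2_le hT hν)
          (le_add_of_nonneg_right (norm_nonneg y0)) (sqrt_add_sq_le_add _ hn y0)
    _ ≤ Cstate (stateConst ν T) T (fun t => ‖f t‖) y0 := by
        rw [← normL2_norm f]
        refine mul_mul_exp_le_Cstate (stateConst_pos hν hT).le ?_ ?_ T _ y0
        · rw [stateConst, add_assoc _ (_ + 1)]
          exact le_add_of_nonneg_right (by positivity)
        · rw [stateConst, add_right_comm]
          exact le_add_of_nonneg_left (by positivity)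

theorem integral_norm_sq_le_Cstate (h : IsBurgersSolution ν T f y0 y dy z) (hT : 0 < T)
    (hν : 0 < ν) :
    ∫ t, ‖y t‖ ^ 2 ∂timeMeasure T ≤ Cstate (stateConst ν T) T (fun t => ‖f t‖) y0 := by
  have hK := energyConst_pos hν hT
  have hn := normL2_nonneg T f
  set S := normL2 T f ^ 2 + ‖toH y0‖ ^ 2 with hS_def
  have hS : 0 ≤ S := by positivity
  calc ∫ t, ‖y t‖ ^ 2 ∂timeMeasure T ≤ energyConst ν T * (√S * √S) := by
        rw [Real.mul_self_sqrt hS]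
        exact h.integral_norm_sq_le hT hν
    _ ≤ energyConst ν T * ((normL2 T f + ‖y0‖) * Real.exp S) := by
        gcongr
        · exact sqrt_add_sq_le_add _ hn y0
        · exact sqrt_le_exp hS
    _ = energyConst ν T * (normL2 T f + ‖y0‖) * Real.exp (1 * S) := by rw [one_mul, mul_assoc]
    _ ≤ Cstate (stateConst ν T) T (fun t => ‖f t‖) y0 := by
        rw [hS_def, ← normL2_norm f]
        refine mul_mul_exp_le_Cstate (stateConst_pos hν hT).le ?_ ?_ T _ y0
        · rw [stateConst]
          exact le_add_of_nonneg_left (by positivity)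
        · rw [stateConst, ← add_assoc, add_right_comm]
          exact le_add_of_nonneg_left (by positivity)

end IsBurgersSolution

theorem sq_integral_le {α : Type*} [MeasurableSpace α] {μ : Measure α} [IsFiniteMeasure μ]
    {g : α → ℝ} (hg : MemLp g 2 μ) : (∫ x, g x ∂μ) ^ 2 ≤ μ.real univ * ∫ x, g x ^ 2 ∂μ := by
  rcases eq_or_ne μ 0 with rfl | hμ
  · simp
  have : NeZero μ := ⟨hμ⟩
  have hμ_pos : 0 < μ.real univ := measureReal_univ_pos
  have jensen : (⨍ x, g x ∂μ) ^ 2 ≤ ⨍ x, g x ^ 2 ∂μ :=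
    (even_two.convexOn_pow (𝕜 := ℝ)).map_average_le (continuous_pow 2).continuousOn isClosed_univ
      (Eventually.of_forall fun _ => mem_univ _) (hg.integrable one_le_two) hg.integrable_sq
  rw [average_eq, average_eq, smul_eq_mul, smul_eq_mul, mul_pow, inv_pow,
    inv_mul_le_iff₀ (by positivity)] at jensen
  refine jensen.trans_eq ?_
  field_simp

theorem sq_le_of_sq_sub_le {x y c : ℝ} (h : (x - y) ^ 2 ≤ c) : x ^ 2 ≤ 2 * y ^ 2 + 2 * c := by
  nlinarith [sq_nonneg (x - y - y)]

namespace MemH1Time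

variable {T : ℝ} {f df : ℝ → ℝ}

theorem sq_sub_le (h : MemH1Time T f df) (hT : 0 < T) (hf : ContinuousOn f (Icc 0 T)) {t : ℝ}
    (ht : t ∈ Icc 0 T) : (f t - f 0) ^ 2 ≤ T * ∫ r, df r ^ 2 ∂timeMeasure T := by
  rw [h.weakDeriv.sub_eq_integral hT.ne (h.memLp.integrable one_le_two)
    (h.memLp_deriv.integrable one_le_two) hf (Eventually.of_forall fun _ => rfl)
    (left_mem_Icc.2 hT.le) ht, ← integral_timeMeasure ht.1]
  refine (sq_integral_le (h.memLp_deriv.mono_measure (timeMeasure_mono ht.2))).trans ?_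
  have hreal : (timeMeasure t).real univ = t := by
    simp [timeMeasure, Measure.real, ht.1]
  rw [hreal]
  have hmono : ∫ r, df r ^ 2 ∂timeMeasure t ≤ ∫ r, df r ^ 2 ∂timeMeasure T :=
    integral_timeMeasure_mono ht.2 (fun _ => sq_nonneg _) h.memLp_deriv.integrable_sq
  exact mul_le_mul ht.2 hmono (integral_nonneg fun _ => sq_nonneg _) hT.le

theorem integral_sq_le (h : MemH1Time T f df) (hT : 0 < T) (hf : ContinuousOn f (Icc 0 T)) :
    ∫ t, f t ^ 2 ∂timeMeasure T
      ≤ T * (2 * f 0 ^ 2 + 2 * (T * ∫ t, df t ^ 2 ∂timeMeasure T)) := by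
  rw [integral_timeMeasure hT.le]
  refine (intervalIntegral.integral_mono_on hT.le
    ((integrable_timeMeasure_iff hT.le).1 h.memLp.integrable_sq) intervalIntegrable_const
    fun t ht => sq_le_of_sq_sub_le (h.sq_sub_le hT hf ht)).trans_eq ?_
  rw [intervalIntegral.integral_const, smul_eq_mul, sub_zero]

end MemH1Time

section Grid

variable {n : ℕ}

theorem sum_rightNeighbour (B : ℝ) (X : Fin (n + 1) → ℝ) :
    ∑ i, rightNeighbour B X i = (∑ i : Fin n, X i.succ) + B := by
  rw [Fin.sum_univ_castSucc]
  congr 1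
  · refine Finset.sum_congr rfl fun i _ => ?_
    rw [rightNeighbour, dif_pos (by simp)]
    rfl
  · simp [rightNeighbour]

theorem sum_leftNeighbour (A : ℝ) (X : Fin (n + 1) → ℝ) :
    ∑ i, leftNeighbour A X i = A + ∑ i : Fin n, X i.castSucc := by
  rw [Fin.sum_univ_succ]
  rfl

variable {a b η : ℝ} {N : ℕ} {X h : Fin N → ℝ}

theorem IsInitialGrid.sum_distance_le (hX : IsInitialGrid a b η X h) :
    ∑ i, h i ≤ 2 * |b - a + 2 * η| := by
  rcases N with _ | n
  · simp
  have hsum : ∑ i, h i ≤ ∑ i, (rightNeighbour (b + η) X i - leftNeighbour (a - η) X i) :=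
    Finset.sum_le_sum fun i _ => hX.distance_le i
  rw [Finset.sum_sub_distrib, sum_rightNeighbour, sum_leftNeighbour] at hsum
  linarith [Fin.sum_univ_succ X, Fin.sum_univ_castSucc X, (hX.mem_Icc 0).1,
    (hX.mem_Icc (Fin.last n)).2, le_abs_self (b - a + 2 * η)]

theorem IsInitialGrid.abs_le (hX : IsInitialGrid a b η X h) (i : Fin N) :
    |X i| ≤ |a| + |b| + |η| := by
  obtain ⟨hleft, hright⟩ := hX.mem_Icc i
  rw [_root_.abs_le]
  constructor <;>
    linarith [neg_abs_le a, le_abs_self b, le_abs_self η, abs_nonneg a, abs_nonneg b]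

end Grid

theorem continuous_particleSum {ζ : ℝ → ℝ} (hζ : Continuous ζ) (ε : ℝ) {N : ℕ}
    (α Φ : Fin N → ℝ → ℝ) (t : ℝ) : Continuous (particleSum ζ ε α Φ t) := by
  unfold particleSum deltaEps
  fun_prop

section Particles

variable {T : ℝ} {N : ℕ} {y : ℝ → V} {Φ dΦ : Fin N → ℝ → ℝ} {h : Fin N → ℝ} {m σ : ℝ}

theorem IsParticleSolution.ae_velocity_eq_rep {ν : ℝ} {χ u ζ : ℝ → ℝ} {y0 : V} {ε : ℝ}
    {dy : ℝ → VDual} (hs : IsParticleSolution ν T χ u y0 ζ ε y dy Φ dΦ) (hζ : Continuous ζ)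
    (i : Fin N) : ∀ᵐ t ∂timeMeasure T, dΦ i t = rep (y t) (Φ i t) := by
  obtain ⟨α, hform, hvelocity⟩ := hs.particle
  filter_upwards [hform, hvelocity i] with t ht hti
  rw [hti, eq_rep_of_ae_eq (continuous_particleSum hζ ε α Φ t) ht]

theorem integral_sq_le_of_ae_eq_rep {φ dφ : ℝ → ℝ} (hy : MemLp y 2 (timeMeasure T))
    (hv : ∀ᵐ t ∂timeMeasure T, dφ t = rep (y t) (φ t)) :
    ∫ t, dφ t ^ 2 ∂timeMeasure T ≤ ∫ t, ‖y t‖ ^ 2 ∂timeMeasure T := by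
  refine integral_mono_of_nonneg (Eventually.of_forall fun t => sq_nonneg _)
    (hy.integrable_norm_pow two_ne_zero) ?_
  filter_upwards [hv] with t ht
  rw [ht]
  exact sq_le_sq.2 ((abs_rep_le_norm _ _).trans (le_abs_self _))

theorem sum_mul_le_mul {ι : Type*} {s : Finset ι} {w f : ι → ℝ} {c σ : ℝ} (hw : ∀ i ∈ s, 0 ≤ w i)
    (hσ : ∑ i ∈ s, w i ≤ σ) (hc : 0 ≤ c) (hf : ∀ i ∈ s, f i ≤ c) : ∑ i ∈ s, w i * f i ≤ σ * c :=
  calc ∑ i ∈ s, w i * f i ≤ ∑ i ∈ s, w i * c :=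
        Finset.sum_le_sum fun i hi => mul_le_mul_of_nonneg_left (hf i hi) (hw i hi)
    _ = (∑ i ∈ s, w i) * c := (Finset.sum_mul _ _ _).symm
    _ ≤ σ * c := mul_le_mul_of_nonneg_right hσ hc

theorem normP_le (hT : 0 < T) (hy : MemLp y 2 (timeMeasure T))
    (hΦ : ∀ i, MemH1Time T (Φ i) (dΦ i)) (hΦc : ∀ i, ContinuousOn (Φ i) (Icc 0 T))
    (hv : ∀ i, ∀ᵐ t ∂timeMeasure T, dΦ i t = rep (y t) (Φ i t)) (hh : ∀ i, 0 ≤ h i)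
    (hσ : ∑ i, h i ≤ σ) (hm : ∀ i, |Φ i 0| ≤ m) :
    normP T h Φ dΦ
      ≤ ∫ t, ‖y t‖ ^ 2 ∂timeMeasure T + (σ * (2 * T * m ^ 2 + 2 * T ^ 2 + 1) + 1) := by
  have hσ_nonneg : 0 ≤ σ := (Finset.sum_nonneg fun i _ => hh i).trans hσ
  set Y := ∫ t, ‖y t‖ ^ 2 ∂timeMeasure T
  have hY : 0 ≤ Y := integral_nonneg fun _ => sq_nonneg _
  have hvelocity : ∀ i, ∫ t, dΦ i t ^ 2 ∂timeMeasure T ≤ Y := fun i =>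
    integral_sq_le_of_ae_eq_rep hy (hv i)
  have hposition : ∀ i, ∫ t, Φ i t ^ 2 ∂timeMeasure T ≤ T * (2 * m ^ 2 + 2 * (T * Y)) := by
    intro i
    refine ((hΦ i).integral_sq_le hT (hΦc i)).trans ?_
    have := sq_le_sq.2 ((hm i).trans (le_abs_self m))
    gcongr
    exact hvelocity i
  have hsum := add_le_add
    (sum_mul_le_mul (fun i _ => hh i) hσ (by positivity) fun i _ => hposition i)
    (sum_mul_le_mul (fun i _ => hh i) hσ hY fun i _ => hvelocity i)
  set A := σ * (2 * T * m ^ 2 + 2 * T ^ 2 + 1) with hA_def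
  have hA : 0 ≤ A := by positivity
  have hsplit : σ * (T * (2 * m ^ 2 + 2 * (T * Y))) + σ * Y ≤ A + A * Y := by
    rw [hA_def]
    nlinarith [mul_nonneg hσ_nonneg (sq_nonneg T), mul_nonneg hY (mul_nonneg hσ_nonneg
      (mul_nonneg hT.le (sq_nonneg m)))]
  simp only [normP, ← sq]
  refine (Real.sqrt_le_left (by positivity)).2 (hsum.trans (hsplit.trans ?_))
  nlinarith [mul_nonneg hA hY]

/-- The constant `C_supp`, where `2 |b - a + 2 η|` bounds the sum of the weights `h i` and
`|a| + |b| + |η|` the initial positions. -/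
noncomputable def suppConst (T a b η : ℝ) : ℝ :=
  2 * |b - a + 2 * η| * (2 * T * (|a| + |b| + |η|) ^ 2 + 2 * T ^ 2 + 1) + 1

theorem suppConst_pos (hT : 0 ≤ T) (a b η : ℝ) : 0 < suppConst T a b η := by
  rw [suppConst]
  positivity

theorem IsInitialGrid.normP_le {a b η : ℝ} (hX : IsInitialGrid a b η (fun i => Φ i 0) h)
    (hT : 0 < T) (hy : MemLp y 2 (timeMeasure T)) (hΦ : ∀ i, MemH1Time T (Φ i) (dΦ i))
    (hΦc : ∀ i, ContinuousOn (Φ i) (Icc 0 T))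
    (hv : ∀ i, ∀ᵐ t ∂timeMeasure T, dΦ i t = rep (y t) (Φ i t)) :
    normP T h Φ dΦ ≤ ∫ t, ‖y t‖ ^ 2 ∂timeMeasure T + suppConst T a b η :=
  Burgers.normP_le hT hy hΦ hΦc hv (fun i => (hX.distance_pos i).le) hX.sum_distance_le hX.abs_le

end Particles

end Burgers

theorem mainTheorem10_general (T : ℝ) (hT : 0 < T) :
    ∃ Csupp : ℝ → ℝ → ℝ → ℝ, (∀ a b η, 0 < Csupp a b η) ∧
      ∀ (ν : ℝ) (χ : ℝ → ℝ), 0 < ν → MemLp χ 2 volume →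
        ∃ C : ℝ, 0 < C ∧
          ∀ (u : ℝ → ℝ) (y0 : Burgers.V) (y : ℝ → Burgers.V) (dy : ℝ → Burgers.VDual),
            MemLp u 2 (Burgers.timeMeasure T) → Burgers.MemW T y dy →
            MemLp y ∞ (Burgers.timeMeasure T) → Burgers.WeakBurgers ν T χ u y dy →
            Burgers.HasInitialValue T y y0 →
            Burgers.normLinf T y + Burgers.normW T y dy ≤ Burgers.Cstate C T u y0 ∧
            ∀ (N : ℕ) (Φ dΦ : Fin N → ℝ → ℝ) (a b η : ℝ) (h : Fin N → ℝ),
              (∀ i, Burgers.MemH1Time T (Φ i) (dΦ i)) → (∀ i, ContinuousOn (Φ i) (Icc 0 T)) →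
              (∀ i, ∀ᵐ t ∂Burgers.timeMeasure T, dΦ i t = Burgers.rep (y t) (Φ i t)) →
              Burgers.IsInitialGrid a b η (fun i => Φ i 0) h →
              Burgers.normP T h Φ dΦ ≤ Burgers.Cstate C T u y0 + Csupp a b η := by
  refine ⟨Burgers.suppConst T, Burgers.suppConst_pos hT.le, fun ν χ hν hχ => ?_⟩
  have hC := Burgers.stateConst_pos hν hT
  refine ⟨Burgers.stateConst ν T * (1 + ‖hχ.toLp χ‖ ^ 2), by positivity, ?_⟩
  intro u y0 y dy hu hW hy heq hinit
  obtain ⟨z, hz⟩ := heq.exists_isBurgersSolution hχ hu hW hy hinit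
  have hCstate := Burgers.Cstate_norm_smul_le hC.le T (hχ.toLp χ) u y0
  refine ⟨(hz.normLinf_add_normW_le hT hν).trans hCstate, ?_⟩
  intro N Φ dΦ a b η h hΦ hΦc hv hX
  refine (hX.normP_le hT hW.memLp hΦ hΦc hv).trans ?_
  gcongr
  exact (hz.integral_norm_sq_le_Cstate hT hν).trans hCstate

theorem mainTheorem10 (T : ℝ) (hT : 0 < T) :
    ∃ Csupp : ℝ → ℝ → ℝ → ℝ, (∀ a b η, 0 < Csupp a b η) ∧
      ∀ (ν : ℝ) (χ : ℝ → ℝ), 0 < ν → ContDiff ℝ ∞ χ → HasCompactSupport χ →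
        ∃ C : ℝ, 0 < C ∧
          ∀ (ul uu : ℝ) (u : ℝ → ℝ) (a b : ℝ) (y0 : Burgers.V)
            (r : ℕ) (ζ : ℝ → ℝ) (ε : ℝ) (N : ℕ)
            (y : ℝ → Burgers.V) (dy : ℝ → Burgers.VDual) (Φ dΦ : Fin N → ℝ → ℝ),
            ul ≤ uu → Burgers.Admissible T ul uu u →
            a ≤ b → Burgers.SupportedIn y0 a b →
            Burgers.IsKernel r ζ → 0 < ε →
            Burgers.IsParticleSolution ν T χ u y0 ζ ε y dy Φ dΦ →
            Burgers.normLinf T y + Burgers.normW T y dy ≤ Burgers.Cstate C T u y0 ∧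
            ∀ (η : ℝ) (h : Fin N → ℝ), 0 < η →
              Burgers.IsInitialGrid a b η (fun i => Φ i 0) h →
              Burgers.normP T h Φ dΦ ≤ Burgers.Cstate C T u y0 + Csupp a b η := by
  obtain ⟨Csupp, hCsupp, hgeneral⟩ := mainTheorem10_general T hT
  refine ⟨Csupp, hCsupp, fun ν χ hν hχ hχc => ?_⟩
  obtain ⟨C, hC, hbound⟩ := hgeneral ν χ hν (hχ.continuous.memLp_of_hasCompactSupport hχc)
  refine ⟨C, hC, ?_⟩
  intro ul uu u a b y0 r ζ ε N y dy Φ dΦ _ hu _ _ hζ _ hs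
  obtain ⟨⟨du, hdu⟩, _⟩ := hu
  obtain ⟨hstate, hcurves⟩ :=
    hbound u y0 y dy hdu.memLp hs.memW hs.memLinf hs.equation hs.initial
  exact ⟨hstate, fun η h _ hX => hcurves N Φ dΦ a b η h hs.memP hs.continuousOn
    (hs.ae_velocity_eq_rep hζ.smooth.continuous) hX⟩
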